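/- Let $m\ge 2$ and put $c_m=\frac{m}{m+1}$. For $N\ge 0$ equip $\mathbb Z_{m+1}^N$ with the Hamming length $|y|=|\{1\le i\le N: y(i)\ne 0\}|$ and, for $0\le r\le N$, let $\sigma_r$ be the indicator function of the sphere $\{|x|=r\}$ divided by the cardinality of that sphere. With $(g*f)(x)=\sum_y g(y)f(x-y)$, define for functions $f$ on $\mathbb Z_{m+1}^N$ the smooth local and the smooth distant spherical maximal operators $$M^L_S f:=\sup_{L\le c_mN}\Big|\frac1{L+1}\sum_{l\le L}\sigma_l*f\Big|,\qquad M^D_S f:=\sup_{D\le \frac N{m+1}}\Big|\frac1{D+1}\sum_{d\le D}\sigma_{N-d}*f\Big|,$$ where $L, D, l, d$ range over nonnegative integers. Then the following hold. (i) There is a constant $C_m$, depending only on $m$, such that for all $N$, all nonnegative $f:\mathbb Z_{m+1}^N\to\mathbb R$ and all $x\in\mathbb Z_{m+1}^N$, $$M^D_S f(x)\le C_m\, M^L_S(\sigma_N*f)(x).$$ (ii) $M^D_S$ is of weak type $(1,1)$ independently of the dimension: there is a constant $C_{1,m}$, depending only on $m$, such that for all $N$, all $f:\mathbb Z_{m+1}^N\to\mathbb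 C$ and all $\lambda>0$, $$\lambda\,\big|\{x: M^D_Sf(x)>\lambda\}\big|\le C_{1,m}\sum_x|f(x)|.$$ (iii) For every $1<p\le\infty$ there is a constant $C_{p,m}$, depending only on $p$ and $m$, such that for all $N$ and all $f:\mathbb Z_{m+1}^N\to\mathbb C$, with respect to counting measure, $$\|M^D_Sf\|_{L^p(\mathbb Z_{m+1}^N)}\le C_{p,m}\|f\|_{L^p(\mathbb Z_{m+1}^N)}.$$ -/

import Mathlib

open scoped ENNReal NNReal

noncomputable section

/-- The group `(ℤ/(m+1)ℤ)^N`; its `l⁰` (Hamming) metric is given by `hammingNorm`. -/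
abbrev CyclicCube (m N : ℕ) : Type := Fin N → ZMod (m + 1)

/-- The sphere of radius `r` about the origin in the Hamming metric. -/
def hammingSphere (m N r : ℕ) : Finset (CyclicCube m N) :=
  Finset.univ.filter fun x => hammingNorm x = r

/-- The function `σ_r`, the indicator function of the sphere of radius `r` divided by the
cardinality of this sphere. -/
def sphereAvg (m N r : ℕ) (x : CyclicCube m N) : ℝ :=
  if x ∈ hammingSphere m N r then ((hammingSphere m N r).card : ℝ)⁻¹ else 0

variable {m N : ℕ} {E : Type*} [NormedAddCommGroup E] [NormedSpace ℝ E]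

/-- The convolution `(g * f) x = ∑ y, g y f (x - y)` of a real kernel `g` with a function `f`
(in practice real- or complex-valued). -/
def cubeConv (g : CyclicCube m N → ℝ) (f : CyclicCube m N → E) (x : CyclicCube m N) : E :=
  ∑ y, g y • f (x - y)

/-- `cubeConv` agrees with Mathlib's discrete convolution. -/
theorem cubeConv_eq_addConvolution (g : CyclicCube m N → ℝ) (f : CyclicCube m N → E) :
    cubeConv g f = DiscreteConvolution.addConvolution (LinearMap.lsmul ℝ E) g f := by
  funext x
  unfold cubeConv DiscreteConvolution.addConvolution
  let e : CyclicCube m N ≃ DiscreteConvolution.addFiber x :=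
    { toFun := fun y => ⟨(y, x - y), by simp [DiscreteConvolution.mem_addFiber]⟩
      invFun := fun ab => ab.1.1
      left_inv := fun y => rfl
      right_inv := by
        rintro ⟨⟨a, b⟩, h⟩
        have h' : a + b = x := DiscreteConvolution.mem_addFiber.1 h
        subst h'
        simp }
  rw [← e.tsum_eq, tsum_fintype]
  rfl

/-- The smooth local spherical maximal operator
`sup_{L ≤ c_m N} |1/(L+1) ∑_{l ≤ L} σ_l * f|`, where `c_m = m/(m+1)`. -/
def smoothLocalMax (f : CyclicCube m N → E) (x : CyclicCube m N) : ℝ :=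
  ⨆ L : {L : ℕ // (L : ℝ) ≤ (m : ℝ) / (m + 1) * N},
    ‖(1 / ((L : ℕ) + 1 : ℝ)) •
      ∑ l ∈ Finset.range ((L : ℕ) + 1), cubeConv (sphereAvg m N l) f x‖

/-- The smooth distant spherical maximal operator
`sup_{D ≤ N/(m+1)} |1/(D+1) ∑_{d ≤ D} σ_{N-d} * f|`.
All `d` that occur are at most `N`, so that the subtraction `N - d` is not truncated. -/
def smoothDistantMax (f : CyclicCube m N → E) (x : CyclicCube m N) : ℝ :=
  ⨆ D : {D : ℕ // (D : ℝ) ≤ (N : ℝ) / (m + 1)},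
    ‖(1 / ((D : ℕ) + 1 : ℝ)) •
      ∑ d ∈ Finset.range ((D : ℕ) + 1), cubeConv (sphereAvg m N (N - d)) f x‖

/-- The suprema in the two definitions above are over finite sets of radii, hence are maxima. -/
instance finite_natCast_le (c : ℝ) : Finite {L : ℕ // (L : ℝ) ≤ c} :=
  Set.Finite.to_subtype ((Set.finite_Iic ⌊c⌋₊).subset fun _ h => Nat.le_floor h)

end

/-! The distant averages are reduced to local averages of `σ_N * |f|`, and these to the ergodic
averages of a Markov operator.

Distant to local. Add to a uniform point of the sphere of radius `l` an independent uniform point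
with no zero coordinate. A coordinate of the sum can vanish only on the support of the first point,
and does so there with probability `1/m`, independently. Hence `σ_l * σ_N = ∑_d P(Bin(l, 1/m) = d)
σ_{N-d}` (`cubeConv_sphereAvg_top`). Summing over `l ≤ mD` turns the coefficient of `σ_{N-d}` into
`m P(Bin(mD+1, 1/m) ≥ d+1)` (`sum_binomWeight`). For `d ≤ D` this tail is bounded below, since a
binomial variable exceeds its mean with probability bounded below (`le_binomTail`). As `mD ≤ c_m N`,
the kernel inequality `distantKernel_le` follows, and with it (i).

Local to ergodic. The noise kernel at level `p` is the `Bin(N, p)` mixture of the `σ_k`, and the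
noise kernels form a semigroup under convolution. Since `(N+1) ∫_0^P P(Bin(N, p) = k) dp =
P(Bin(N+1, P) ≥ k+1)`, integrating the noise kernels up to a suitable `P = O(L/N)` dominates every
`σ_k` with `k ≤ L`. A Riemann sum along the powers of a single noise operator replaces the integral;
its weights decrease, so it is controlled by maximal ergodic averages
(`smoothLocalMax_le_ergodicMax`).

The maximal ergodic theorem, applied to `σ_N * |f|`, then gives the weak type bound, and Doob's
argument gives `L^p` for `p < ∞`. The case `p = ∞` is immediate, as averages are contractions. -/

section

variable {m N : ℕ} {E : Type*} [NormedAddCommGroup E] [NormedSpace ℝ E]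

/-! ### Binomial weights -/

/-- The binomial probability `P(Bin(n, p) = k)`. -/
def binomWeight (n k : ℕ) (p : ℝ) : ℝ := n.choose k * p ^ k * (1 - p) ^ (n - k)

/-- The expectation of `g` under the binomial distribution `Bin(n, p)`. -/
def binomMean (n : ℕ) (p : ℝ) (g : ℕ → ℝ) : ℝ :=
  ∑ k ∈ Finset.range (n + 1), binomWeight n k p * g k

/-- The binomial tail probability `P(Bin(n, p) ≥ k)`. -/
def binomTail (n k : ℕ) (p : ℝ) : ℝ := binomMean n p fun j => if k ≤ j then 1 else 0

theorem binomWeight_nonneg (n k : ℕ) {p : ℝ} (h0 : 0 ≤ p) (h1 : p ≤ 1) :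
    0 ≤ binomWeight n k p := by
  have : 0 ≤ 1 - p := by linarith
  unfold binomWeight; positivity

theorem binomWeight_of_lt {n k : ℕ} (h : n < k) (p : ℝ) : binomWeight n k p = 0 := by
  simp [binomWeight, Nat.choose_eq_zero_of_lt h]

theorem binomWeight_succ_succ (n k : ℕ) (p : ℝ) :
    binomWeight (n + 1) (k + 1) p = p * binomWeight n k p + (1 - p) * binomWeight n (k + 1) p := by
  unfold binomWeight
  rw [Nat.choose_succ_succ, Nat.add_sub_add_right]
  rcases lt_or_ge k n with h | h
  · have : n - k = n - (k + 1) + 1 := by omega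
    rw [this]; push_cast; ring
  · rw [Nat.choose_eq_zero_of_lt (show n < k + 1 by omega)]; push_cast; ring

theorem binomWeight_succ_zero (n : ℕ) (p : ℝ) :
    binomWeight (n + 1) 0 p = (1 - p) * binomWeight n 0 p := by
  simp [binomWeight, pow_succ']

theorem binomMean_succ (n : ℕ) (p : ℝ) (g : ℕ → ℝ) :
    binomMean (n + 1) p g = (1 - p) * binomMean n p g + p * binomMean n p fun k => g (k + 1) := by
  unfold binomMean
  have h : ∑ k ∈ Finset.range (n + 1), binomWeight n k p * g k =
      ∑ k ∈ Finset.range (n + 1), binomWeight n (k + 1) p * g (k + 1) + binomWeight n 0 p * g 0 := by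
    rw [← Finset.sum_range_succ' (fun k => binomWeight n k p * g k), Finset.sum_range_succ _ (n + 1),
      binomWeight_of_lt (Nat.lt_succ_self n)]
    simp
  rw [Finset.sum_range_succ', h, binomWeight_succ_zero, mul_add, Finset.mul_sum, Finset.mul_sum,
    Finset.sum_congr rfl fun k _ => by rw [binomWeight_succ_succ], add_right_comm,
    ← Finset.sum_add_distrib, mul_assoc]
  congr 1
  exact Finset.sum_congr rfl fun k _ => by ring

theorem binomMean_const (n : ℕ) (p c : ℝ) : (binomMean n p fun _ => c) = c := by
  induction n with
  | zero => simp [binomMean, binomWeight]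
  | succ n ih => rw [binomMean_succ, ih]; ring

theorem binomMean_mono {n : ℕ} {p : ℝ} (h0 : 0 ≤ p) (h1 : p ≤ 1) {g g' : ℕ → ℝ}
    (h : ∀ k, g k ≤ g' k) : binomMean n p g ≤ binomMean n p g' :=
  Finset.sum_le_sum fun k _ => mul_le_mul_of_nonneg_left (h k) (binomWeight_nonneg n k h0 h1)

/-- The free shift `a` makes the induction close: conditioning on one trial replaces `a` by `a - p`
or `a - p + 1`. The same device serves the second and fourth moments. -/
theorem binomMean_centered (n : ℕ) (p a : ℝ) : (binomMean n p fun k => k - n * p + a) = a := by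
  induction n generalizing a with
  | zero => simp [binomMean, binomWeight]
  | succ n ih =>
    have e0 : (fun k : ℕ => (k : ℝ) - (n + 1 : ℕ) * p + a) = fun k : ℕ => k - n * p + (a - p) := by
      funext k; push_cast; ring
    have e1 : (fun k : ℕ => ((k + 1 : ℕ) : ℝ) - n * p + (a - p)) =
        fun k : ℕ => k - n * p + (a - p + 1) := by
      funext k; push_cast; ring
    rw [e0, binomMean_succ, e1, ih, ih]; ring

theorem binomMean_centered_sq (n : ℕ) (p a : ℝ) :
    (binomMean n p fun k => (k - n * p + a) ^ 2) = n * p * (1 - p) + a ^ 2 := by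
  induction n generalizing a with
  | zero => simp [binomMean, binomWeight]
  | succ n ih =>
    have e0 : (fun k : ℕ => ((k : ℝ) - (n + 1 : ℕ) * p + a) ^ 2) =
        fun k : ℕ => (k - n * p + (a - p)) ^ 2 := by
      funext k; push_cast; ring
    have e1 : (fun k : ℕ => (((k + 1 : ℕ) : ℝ) - n * p + (a - p)) ^ 2) =
        fun k : ℕ => (k - n * p + (a - p + 1)) ^ 2 := by
      funext k; push_cast; ring
    rw [e0, binomMean_succ, e1, ih, ih]; push_cast; ring

theorem binomMean_centered_pow_four (n : ℕ) (p a : ℝ) :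
    (binomMean n p fun k => (k - n * p + a) ^ 4) =
      3 * (n * p * (1 - p)) ^ 2 + n * p * (1 - p) * (1 - 6 * p * (1 - p))
        + 4 * a * (n * p * (1 - p) * (1 - 2 * p)) + 6 * a ^ 2 * (n * p * (1 - p)) + a ^ 4 := by
  induction n generalizing a with
  | zero => simp [binomMean, binomWeight]
  | succ n ih =>
    have e0 : (fun k : ℕ => ((k : ℝ) - (n + 1 : ℕ) * p + a) ^ 4) =
        fun k : ℕ => (k - n * p + (a - p)) ^ 4 := by
      funext k; push_cast; ring
    have e1 : (fun k : ℕ => (((k + 1 : ℕ) : ℝ) - n * p + (a - p)) ^ 4) =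
        fun k : ℕ => (k - n * p + (a - p + 1)) ^ 4 := by
      funext k; push_cast; ring
    rw [e0, binomMean_succ, e1, ih, ih]; push_cast; ring

theorem binomTail_zero_right (n : ℕ) (p : ℝ) : binomTail n 0 p = 1 := by
  simpa [binomTail] using binomMean_const n p 1

theorem binomTail_sub_binomTail_succ (n k : ℕ) (p : ℝ) :
    binomTail n k p - binomTail n (k + 1) p = binomWeight n k p := by
  unfold binomTail binomMean
  rw [← Finset.sum_sub_distrib, Finset.sum_eq_single k]
  · simp
  · intro j _ hj
    dsimp only
    rcases lt_or_gt_of_ne hj with h | h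
    · rw [if_neg (by omega), if_neg (by omega)]; simp
    · rw [if_pos (by omega), if_pos (by omega)]; simp
  · intro hk
    rw [binomWeight_of_lt (by simpa using hk)]; simp

theorem binomTail_succ_succ (n k : ℕ) (p : ℝ) :
    binomTail (n + 1) (k + 1) p = binomTail n (k + 1) p + p * binomWeight n k p := by
  rw [← binomTail_sub_binomTail_succ]
  unfold binomTail
  rw [binomMean_succ]
  simp only [add_le_add_iff_right]
  ring

theorem binomTail_antitone {n : ℕ} {p : ℝ} (h0 : 0 ≤ p) (h1 : p ≤ 1) :
    Antitone fun k => binomTail n k p := fun k l hkl => binomMean_mono h0 h1 fun j => by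
  split_ifs <;> first | omega | norm_num

/-- Waiting times: `p * binomWeight l d p` is the probability that success number `d + 1` occurs at
trial `l + 1`. Summing over `l < L` gives at least `d + 1` successes in `L` trials. -/
theorem sum_binomWeight (L d : ℕ) (p : ℝ) :
    p * ∑ l ∈ Finset.range L, binomWeight l d p = binomTail L (d + 1) p := by
  induction L with
  | zero => simp [binomTail, binomMean, binomWeight]
  | succ L ih => rw [Finset.sum_range_succ, mul_add, ih, binomTail_succ_succ]

theorem binomTail_succ_zero_prob (n k : ℕ) : binomTail n (k + 1) 0 = 0 := by
  rw [← sum_binomWeight]; simp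

theorem binomWeight_eq_eval (n k : ℕ) :
    binomWeight n k = fun p => (bernsteinPolynomial ℝ n k).eval p := by
  funext p; simp [binomWeight, bernsteinPolynomial]

/-- The tail is the distribution function of the order statistic of rank `k + 1` among `n + 1`
uniform variables, and the derivative is its beta density. The induction telescopes the derivatives
of Bernstein polynomials. -/
theorem hasDerivAt_binomTail (n k : ℕ) (p : ℝ) :
    HasDerivAt (binomTail (n + 1) (k + 1)) ((n + 1) * binomWeight n k p) p := by
  have h (j : ℕ) : binomTail (n + 1) (j + 1) =
      fun p => binomTail (n + 1) j p - (bernsteinPolynomial ℝ (n + 1) j).eval p := by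
    funext p
    have := binomTail_sub_binomTail_succ (n + 1) j p
    rw [binomWeight_eq_eval] at this
    linarith
  induction k with
  | zero =>
    rw [h, show binomTail (n + 1) 0 = fun _ => 1 from funext (binomTail_zero_right _)]
    convert! (hasDerivAt_const p (1 : ℝ)).sub (Polynomial.hasDerivAt _ p) using 1
    rw [bernsteinPolynomial.derivative_zero, binomWeight_eq_eval]
    simp
    ring
  | succ k ih =>
    rw [h]
    convert! ih.sub (Polynomial.hasDerivAt _ p) using 1
    rw [bernsteinPolynomial.derivative_succ, binomWeight_eq_eval, binomWeight_eq_eval]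
    simp
    ring

theorem monotoneOn_binomTail (n k : ℕ) :
    MonotoneOn (binomTail (n + 1) (k + 1)) (Set.Icc 0 1) := by
  refine monotoneOn_of_deriv_nonneg (convex_Icc 0 1)
    (fun p _ => (hasDerivAt_binomTail n k p).continuousAt.continuousWithinAt)
    (fun p _ => (hasDerivAt_binomTail n k p).differentiableAt.differentiableWithinAt) fun p hp => ?_
  rw [interior_Icc] at hp
  rw [(hasDerivAt_binomTail n k p).deriv]
  have := binomWeight_nonneg n k hp.1.le hp.2.le
  positivity

/-! ### Anticoncentration -/

/-- A one-sided Paley–Zygmund inequality with fourth moments. -/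
theorem sum_pos_part_ge_of_fourth_moment {ι : Type*} (s : Finset ι) (w z : ι → ℝ) {κ : ℝ}
    (hκ : 1 ≤ κ) (hw : ∀ i ∈ s, 0 ≤ w i) (h1 : ∑ i ∈ s, w i * z i = 0)
    (h2 : ∑ i ∈ s, w i * z i ^ 2 = 1) (h4 : ∑ i ∈ s, w i * z i ^ 4 ≤ κ) :
    1 / (6 * κ ^ 2) ≤ ∑ i ∈ s, w i * if 0 < z i then 1 else 0 := by
  have hκ0 : 0 < κ := by linarith
  -- Polynomial minorant of a multiple of the indicator of `y > 0`. Its mean is at least `0 + 1 -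
  -- 1/2` by the moment hypotheses, whence the constant `1 / (6 κ²)`.
  have key (y : ℝ) : κ * y + y ^ 2 - y ^ 4 / (2 * κ) ≤ 3 * κ ^ 2 * if 0 < y then 1 else 0 := by
    have e : y ^ 4 / (2 * κ) * (2 * κ) = y ^ 4 := by field_simp
    split_ifs with hy
    · rcases le_or_gt y (2 * κ) with h | h
      · have h3 : y ^ 2 - y ^ 4 / (2 * κ) ≤ κ / 2 := by
          have : (κ / 2 - (y ^ 2 - y ^ 4 / (2 * κ))) * (2 * κ) = (y ^ 2 - κ) ^ 2 := by
            linear_combination e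
          nlinarith [sq_nonneg (y ^ 2 - κ)]
        nlinarith
      · have h3 : κ * y + y ^ 2 ≤ y ^ 4 / (2 * κ) := by
          rw [le_div_iff₀ (by positivity)]
          have a1 : 2 * κ * y ^ 2 ≤ y ^ 3 := by nlinarith [sq_nonneg y]
          have a2 : 2 * κ * (κ * y) ≤ y ^ 3 := by nlinarith [mul_pos hκ0 hy]
          have a3 : 2 * y ^ 3 ≤ y ^ 4 := by nlinarith [pow_pos hy 3]
          nlinarith
        nlinarith [sq_nonneg κ]
    · have hy' : 0 ≤ -y := by linarith
      rw [mul_zero]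
      rcases le_or_gt (-y) κ with h | h
      · have : 0 ≤ y ^ 4 / (2 * κ) := by positivity
        nlinarith
      · have h3 : κ * y + y ^ 2 ≤ y ^ 4 / (2 * κ) := by
          rw [le_div_iff₀ (by positivity)]
          have hz : ∀ t : ℝ, κ < t → (-(κ * t) + t ^ 2) * (2 * κ) ≤ t ^ 4 := by
            intro t ht
            have : 0 < t := by linarith
            have a1 : 2 * κ * (t - κ) ≤ t ^ 2 := by nlinarith [sq_nonneg (t - κ), sq_nonneg κ]
            have a2 : t ≤ t ^ 2 := by nlinarith
            nlinarith [mul_le_mul_of_nonneg_left a1 this.le, mul_le_mul_of_nonneg_left a2 (sq_nonneg t)]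
          have := hz (-y) h
          nlinarith
        linarith
  have hsum := Finset.sum_le_sum fun i hi => mul_le_mul_of_nonneg_left (key (z i)) (hw i hi)
  have e1 : ∑ i ∈ s, w i * (κ * z i + z i ^ 2 - z i ^ 4 / (2 * κ)) =
      κ * ∑ i ∈ s, w i * z i + ∑ i ∈ s, w i * z i ^ 2 - (∑ i ∈ s, w i * z i ^ 4) / (2 * κ) := by
    rw [Finset.mul_sum, Finset.sum_div, ← Finset.sum_add_distrib, ← Finset.sum_sub_distrib]
    exact Finset.sum_congr rfl fun i _ => by ring
  have e2 : ∑ i ∈ s, w i * (3 * κ ^ 2 * if 0 < z i then 1 else 0) =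
      3 * κ ^ 2 * ∑ i ∈ s, w i * if 0 < z i then 1 else 0 := by
    rw [Finset.mul_sum]
    exact Finset.sum_congr rfl fun i _ => by ring
  rw [e1, e2, h1, h2] at hsum
  have h5 : (∑ i ∈ s, w i * z i ^ 4) / (2 * κ) ≤ 1 / 2 := by
    rw [div_le_iff₀ (by positivity)]; linarith
  rw [div_le_iff₀ (by positivity)]
  linarith

/-- If `1 ≤ L ≤ c N` with `c = m/(m+1)`, the binomial tail beyond the mean is bounded below. -/
theorem le_binomTail (m : ℕ) {N L : ℕ} (hL : 1 ≤ L) (hLN : (L : ℝ) ≤ (m : ℝ) / (m + 1) * N) :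
    1 / (6 * ((m : ℝ) + 4) ^ 2) ≤ binomTail (N + 1) (L + 1) ((L : ℝ) / N) := by
  have hL' : (1 : ℝ) ≤ L := by exact_mod_cast hL
  have hN : (0 : ℝ) < N := by
    rcases Nat.eq_zero_or_pos N with h | h
    · subst h; norm_num at hLN; omega
    · exact_mod_cast h
  set p : ℝ := L / N with hp
  have hpc : p ≤ (m : ℝ) / (m + 1) := by rw [hp, div_le_iff₀ hN]; exact hLN
  have hq : 1 / ((m : ℝ) + 1) ≤ 1 - p := by
    have : (m : ℝ) / (m + 1) + 1 / (m + 1) = 1 := by field_simp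
    linarith
  have hm1 : 0 < 1 / ((m : ℝ) + 1) := by positivity
  have hp0 : 0 < p := by positivity
  have hp1 : p < 1 := by linarith
  have hNp : N * p = L := by rw [hp]; field_simp
  set v : ℝ := ((N + 1 : ℕ) : ℝ) * p * (1 - p) with hv
  have hvm : 1 / ((m : ℝ) + 1) ≤ v := by
    have : 1 ≤ ((N + 1 : ℕ) : ℝ) * p := by push_cast; nlinarith
    nlinarith
  have hv0 : 0 < v := by linarith
  have hsq : √v ^ 2 = v := Real.sq_sqrt hv0.le
  have hs : 0 < √v := Real.sqrt_pos.2 hv0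
  -- The mean of `Bin(N + 1, L/N)` is `L + L/N`, so a value above it is at least `L + 1`. The fourth
  -- central moment is at most `3v² + v`, and `v ≥ 1/(m+1)` makes this at most `(m+4) v²`; hence `κ
  -- = m + 4`.
  have key := sum_pos_part_ge_of_fourth_moment (Finset.range (N + 1 + 1))
    (fun k => binomWeight (N + 1) k p)
    (fun k => ((k : ℝ) - (N + 1 : ℕ) * p) / √v) (κ := (m : ℝ) + 4) (by linarith [(m.cast_nonneg : (0 : ℝ) ≤ m)])
    (fun k _ => binomWeight_nonneg _ _ hp0.le hp1.le) ?_ ?_ ?_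
  · refine key.trans (Finset.sum_le_sum fun k _ =>
      mul_le_mul_of_nonneg_left ?_ (binomWeight_nonneg _ _ hp0.le hp1.le))
    dsimp only
    by_cases h : 0 < ((k : ℝ) - (N + 1 : ℕ) * p) / √v
    · have h' : 0 < (k : ℝ) - (N + 1 : ℕ) * p := by
        rwa [div_pos_iff_of_pos_right hs] at h
      have : (L : ℝ) < k := by push_cast at h'; nlinarith
      rw [if_pos h, if_pos (by exact_mod_cast this)]
    · rw [if_neg h]; split_ifs <;> norm_num
  · have := binomMean_centered (N + 1) p 0
    simp only [add_zero, binomMean] at this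
    simp only [← mul_div_assoc]
    rw [← Finset.sum_div, this, zero_div]
  · have := binomMean_centered_sq (N + 1) p 0
    simp only [add_zero, binomMean] at this
    simp only [div_pow, hsq, ← mul_div_assoc]
    rw [← Finset.sum_div, this, div_eq_one_iff_eq hv0.ne']
    simp [hv]
  · have := binomMean_centered_pow_four (N + 1) p 0
    simp only [add_zero, binomMean] at this
    have h4 : √v ^ 4 = v ^ 2 := by rw [show 4 = 2 * 2 from rfl, pow_mul, hsq]
    simp only [div_pow, h4, ← mul_div_assoc]
    rw [← Finset.sum_div, this, ← hv, div_le_iff₀ (by positivity)]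
    have h5 : 1 ≤ v * (m + 1) := by rwa [div_le_iff₀ (by positivity)] at hvm
    have h6 : 0 ≤ v * (p * (1 - p)) := by
      have : 0 ≤ 1 - p := by linarith
      positivity
    nlinarith

/-! ### Convolution on the cyclic cube -/

theorem cubeConv_assoc (g h : CyclicCube m N → ℝ) (f : CyclicCube m N → E) :
    cubeConv g (cubeConv h f) = cubeConv (cubeConv g h) f := by
  funext x
  simp only [cubeConv, Finset.smul_sum, Finset.sum_smul, smul_smul, smul_eq_mul]
  rw [Finset.sum_comm (f := fun v y => (g y * h (v - y)) • f (x - v))]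
  refine Finset.sum_congr rfl fun y _ => ?_
  rw [← Equiv.sum_comp (Equiv.addRight y) fun v => (g y * h (v - y)) • f (x - v)]
  simp [sub_sub, add_comm]

theorem cubeConv_mono_left {g h : CyclicCube m N → ℝ} {f : CyclicCube m N → ℝ}
    (hgh : ∀ y, g y ≤ h y) (hf : ∀ y, 0 ≤ f y) (x : CyclicCube m N) :
    cubeConv g f x ≤ cubeConv h f x :=
  Finset.sum_le_sum fun y _ => mul_le_mul_of_nonneg_right (hgh y) (hf _)

theorem cubeConv_nonneg {g f : CyclicCube m N → ℝ} (hg : ∀ y, 0 ≤ g y) (hf : ∀ y, 0 ≤ f y)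
    (x : CyclicCube m N) : 0 ≤ cubeConv g f x :=
  Finset.sum_nonneg fun y _ => mul_nonneg (hg y) (hf _)

theorem smul_sum_cubeConv (c : ℝ) {ι : Type*} (s : Finset ι) (g : ι → CyclicCube m N → ℝ)
    (f : CyclicCube m N → E) (x : CyclicCube m N) :
    c • ∑ i ∈ s, cubeConv (g i) f x = cubeConv (fun y => c * ∑ i ∈ s, g i y) f x := by
  simp only [cubeConv, mul_smul, Finset.sum_smul, ← Finset.smul_sum]
  rw [Finset.sum_comm]

theorem norm_cubeConv_le {g : CyclicCube m N → ℝ} (hg : ∀ y, 0 ≤ g y) (f : CyclicCube m N → E)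
    (x : CyclicCube m N) : ‖cubeConv g f x‖ ≤ cubeConv g (fun y => ‖f y‖) x := by
  refine (norm_sum_le _ _).trans_eq (Finset.sum_congr rfl fun y _ => ?_)
  rw [norm_smul, Real.norm_of_nonneg (hg y), smul_eq_mul]

theorem sum_cubeConv (g f : CyclicCube m N → ℝ) :
    ∑ x, cubeConv g f x = (∑ y, g y) * ∑ x, f x := by
  simp only [cubeConv]
  rw [Finset.sum_comm, Finset.sum_mul]
  refine Finset.sum_congr rfl fun y _ => ?_
  simp only [smul_eq_mul]
  rw [← Finset.mul_sum, ← (Equiv.subRight y).sum_comp f]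
  rfl

/-! ### Cardinality of spheres -/

theorem coeff_one_add_C_mul_X_pow (a : ℝ) (n k : ℕ) :
    ((1 + Polynomial.C a * Polynomial.X) ^ n).coeff k = n.choose k * a ^ k := by
  rw [add_comm, add_pow]
  simp only [one_pow, mul_one, mul_pow, ← Polynomial.C_pow, Polynomial.finsetSum_coeff]
  rw [Finset.sum_eq_single k]
  · rw [← Polynomial.C_eq_natCast, Polynomial.coeff_mul_C, Polynomial.coeff_C_mul_X_pow]
    simp [mul_comm]
  · intro j _ hj
    rw [← Polynomial.C_eq_natCast, Polynomial.coeff_mul_C, Polynomial.coeff_C_mul_X_pow]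
    simp [hj.symm]
  · intro hk
    rw [Nat.choose_eq_zero_of_lt (by simpa using hk)]; simp

theorem pow_hammingNorm {R : Type*} [CommMonoid R] (t : R) (y : CyclicCube m N) :
    t ^ hammingNorm y = ∏ i, if y i = 0 then 1 else t := by
  rw [Finset.prod_ite]
  simp [hammingNorm]

theorem prod_ite_zero {R : Type*} [CommMonoid R] (s t : R) (y : CyclicCube m N) :
    (∏ i, if y i = 0 then s else t) = s ^ (N - hammingNorm y) * t ^ hammingNorm y := by
  have h : (Finset.univ.filter fun i => y i = 0).card + hammingNorm y = N := by
    simpa [hammingNorm] using Finset.card_filter_add_card_filter_not (s := Finset.univ) fun i => y i = 0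
  rw [Finset.prod_ite, Finset.prod_const, Finset.prod_const, ← Nat.eq_sub_of_add_eq h]
  rfl

theorem hammingNorm_le (y : CyclicCube m N) : hammingNorm y ≤ N := by
  simpa using hammingNorm_le_card_fintype (x := y)

/-- Generating function of the weight: a coordinate contributes `1` for the value zero and `X` for
each nonzero value, and coordinates multiply. -/
theorem card_filter_hammingNorm (S : Fin N → Finset (ZMod (m + 1))) (k : ℕ) :
    (((Fintype.piFinset S).filter fun y => hammingNorm y = k).card : ℝ) =
      (∏ i, ∑ a ∈ S i, if a = 0 then (1 : Polynomial ℝ) else Polynomial.X).coeff k := by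
  rw [Finset.prod_univ_sum]
  simp only [← pow_hammingNorm, Polynomial.finsetSum_coeff, Polynomial.coeff_X_pow]
  rw [Finset.sum_boole]
  simp [eq_comm]

theorem sum_zmod_ite {R : Type*} [CommRing R] (s t : R) :
    (∑ a : ZMod (m + 1), if a = 0 then s else t) = s + m * t := by
  rw [← Finset.add_sum_erase _ _ (Finset.mem_univ 0), if_pos rfl,
    Finset.sum_congr rfl fun a ha => if_neg (Finset.ne_of_mem_erase ha)]
  simp [Finset.card_erase_of_mem, ZMod.card]

theorem card_hammingSphere (m N k : ℕ) :
    ((hammingSphere m N k).card : ℝ) = N.choose k * (m : ℝ) ^ k := by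
  have := card_filter_hammingNorm (m := m) (N := N) (fun _ => Finset.univ) k
  rw [Fintype.piFinset_univ] at this
  rw [hammingSphere, this, sum_zmod_ite, Finset.prod_const, Finset.card_univ, Fintype.card_fin,
    ← coeff_one_add_C_mul_X_pow]
  simp

theorem sphereAvg_nonneg (r : ℕ) (y : CyclicCube m N) : 0 ≤ sphereAvg m N r y := by
  unfold sphereAvg; split_ifs <;> positivity

theorem sphereAvg_of_ne {r : ℕ} {y : CyclicCube m N} (h : hammingNorm y ≠ r) :
    sphereAvg m N r y = 0 := by
  simp [sphereAvg, hammingSphere, h]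

theorem sphereAvg_of_eq {r : ℕ} {y : CyclicCube m N} (h : hammingNorm y = r) :
    sphereAvg m N r y = (N.choose r * (m : ℝ) ^ r)⁻¹ := by
  rw [← card_hammingSphere]
  simp [sphereAvg, hammingSphere, h]

theorem sum_sphereAvg (hm : 1 ≤ m) {r : ℕ} (hr : r ≤ N) : ∑ y, sphereAvg m N r y = 1 := by
  unfold sphereAvg
  rw [Finset.sum_ite_mem, Finset.univ_inter, Finset.sum_const, nsmul_eq_mul, mul_inv_cancel₀]
  rw [card_hammingSphere]
  have := Nat.choose_pos hr
  positivity

theorem sphereAvg_zero (y : CyclicCube m N) : sphereAvg m N 0 y = if y = 0 then 1 else 0 := by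
  split_ifs with h
  · rw [sphereAvg_of_eq (by simp [h])]; simp
  · exact sphereAvg_of_ne (by simpa using h)

theorem cubeConv_sphereAvg_zero (f : CyclicCube m N → E) : cubeConv (sphereAvg m N 0) f = f := by
  funext x
  simp [cubeConv, sphereAvg_zero]

/-! ### The convolution of a sphere with the largest sphere -/

theorem sum_zmod_filter_ne_ite (b : ZMod (m + 1)) :
    (∑ a ∈ Finset.univ.filter (· ≠ b), if a = 0 then (1 : Polynomial ℝ) else Polynomial.X) =
      if b = 0 then Polynomial.C (m : ℝ) * Polynomial.X
      else 1 + Polynomial.C ((m : ℝ) - 1) * Polynomial.X := by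
  have h := sum_zmod_ite (m := m) (1 : Polynomial ℝ) Polynomial.X
  rw [← Finset.add_sum_erase _ _ (Finset.mem_univ b)] at h
  rw [Finset.filter_ne']
  split_ifs at h ⊢ with hb
  · simpa using h
  · simp only [Polynomial.C_sub, map_natCast, Polynomial.C_1]
    linear_combination h

/-- The condition `hammingNorm (z - y) = N` says that `y` differs from `z` in every coordinate. The
`d` zeros of `z` contribute `mX` each and the other coordinates `1 + (m-1)X` each, so the count is a
coefficient of the product. -/
theorem card_filter_sub_mem (z : CyclicCube m N) {d : ℕ} (hd : d ≤ N) (hz : hammingNorm z = N - d)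
    (l : ℕ) :
    ((Finset.univ.filter fun y : CyclicCube m N => hammingNorm y = l ∧ hammingNorm (z - y) = N).card
      : ℝ) = if d ≤ l then (m : ℝ) ^ d * ((N - d).choose (l - d) * ((m : ℝ) - 1) ^ (l - d)) else 0 := by
  have h := card_filter_hammingNorm (fun i => Finset.univ.filter (· ≠ z i)) l
  simp only [sum_zmod_filter_ne_ite] at h
  rw [prod_ite_zero, hz, Nat.sub_sub_self hd, mul_pow, ← Polynomial.C_pow, mul_assoc,
    Polynomial.coeff_C_mul, mul_comm (Polynomial.X ^ d), Polynomial.coeff_mul_X_pow'] at h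
  simp only [coeff_one_add_C_mul_X_pow, mul_ite, mul_zero] at h
  rw [← h]
  congr 2
  ext y
  have hN : hammingNorm (z - y) = N ↔ ∀ i, y i ≠ z i := by
    have : hammingNorm (z - y) = N ↔
        (Finset.univ.filter fun i => (z - y) i ≠ 0).card = (Finset.univ : Finset (Fin N)).card := by
      simp [hammingNorm]
    rw [this, Finset.card_filter_eq_iff]
    simp [sub_eq_zero, eq_comm]
  simp [hN, and_comm]

/-- After counting, the binomial weight appears through `C(N,l) C(l,d) = C(N,d) C(N-d,l-d)`. -/
theorem cubeConv_sphereAvg_top (hm : 1 ≤ m) {d l : ℕ} (hd : d ≤ N) (hl : l ≤ N)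
    {z : CyclicCube m N} (hz : hammingNorm z = N - d) :
    cubeConv (sphereAvg m N l) (sphereAvg m N N) z =
      binomWeight l d (1 / m) * sphereAvg m N (N - d) z := by
  have h : cubeConv (sphereAvg m N l) (sphereAvg m N N) z =
      (Finset.univ.filter fun y : CyclicCube m N =>
        hammingNorm y = l ∧ hammingNorm (z - y) = N).card *
        ((N.choose l * (m : ℝ) ^ l)⁻¹ * (N.choose N * (m : ℝ) ^ N)⁻¹) := by
    rw [Finset.card_filter, Nat.cast_sum, Finset.sum_mul, cubeConv]
    refine Finset.sum_congr rfl fun y _ => ?_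
    by_cases h1 : hammingNorm y = l
    · by_cases h2 : hammingNorm (z - y) = N
      · simp [h1, h2, sphereAvg_of_eq]
      · simp [h2, sphereAvg_of_ne]
    · simp [h1, sphereAvg_of_ne]
  rw [h, card_filter_sub_mem z hd hz, sphereAvg_of_eq hz]
  split_ifs with hdl
  · have hm0 : (m : ℝ) ≠ 0 := by positivity
    have c1 : (N.choose l : ℝ) ≠ 0 := by exact_mod_cast (Nat.choose_pos hl).ne'
    have c2 : (N.choose d : ℝ) ≠ 0 := by exact_mod_cast (Nat.choose_pos hd).ne'
    have e : (N.choose l : ℝ) * l.choose d = N.choose d * (N - d).choose (l - d) := by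
      exact_mod_cast Nat.choose_mul (n := N) hdl
    obtain ⟨a, rfl⟩ := Nat.exists_eq_add_of_le hdl
    obtain ⟨b, rfl⟩ := Nat.exists_eq_add_of_le hd
    simp only [Nat.add_sub_cancel_left] at *
    rw [Nat.choose_symm_add (a := d) (b := b)] at c2 e
    have e2 : 1 - 1 / (m : ℝ) = (m - 1) / m := by field_simp
    rw [binomWeight, e2, Nat.add_sub_cancel_left, Nat.choose_self]
    simp only [div_pow, one_pow, pow_add]
    field_simp
    push_cast
    linear_combination (-((m : ℝ) - 1) ^ a) * e
  · rw [binomWeight_of_lt (by omega)]; simp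

/-- The averages of the distant sphere kernels are dominated by averages of local sphere kernels
convolved with the largest sphere. -/
theorem distantKernel_le (hm : 2 ≤ m) {D : ℕ} (hD : (D : ℝ) ≤ (N : ℝ) / (m + 1))
    (z : CyclicCube m N) :
    1 / ((D : ℝ) + 1) * ∑ d ∈ Finset.range (D + 1), sphereAvg m N (N - d) z ≤
      6 * ((m : ℝ) + 4) ^ 2 * (1 / (((m * D : ℕ) : ℝ) + 1) * ∑ l ∈ Finset.range (m * D + 1),
        cubeConv (sphereAvg m N l) (sphereAvg m N N) z) := by
  have hm' : (2 : ℝ) ≤ m := by exact_mod_cast hm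
  have hDN : (m + 1) * D ≤ N := by
    rw [le_div_iff₀ (by positivity)] at hD
    have : ((D * (m + 1) : ℕ) : ℝ) ≤ N := by push_cast; exact hD
    rw [mul_comm]; exact_mod_cast this
  have hmD : m * D ≤ N := by nlinarith
  have hDN' : D ≤ N := by nlinarith
  have hzN := hammingNorm_le z
  by_cases h : N - hammingNorm z ≤ D
  · set d := N - hammingNorm z with hd
    have hz : hammingNorm z = N - d := by omega
    have hdN : d ≤ N := by omega
    -- The point `z` lies on exactly one sphere, so one term of the distant sum survives.
    rw [Finset.sum_eq_single_of_mem d (by simp; omega)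
      fun j hj hjd => sphereAvg_of_ne (by simp at hj; omega)]
    rw [Finset.sum_congr rfl fun l hl => cubeConv_sphereAvg_top (by omega) hdN
      (show l ≤ N by simp at hl; omega) hz, ← Finset.sum_mul]
    have hsum : ∑ l ∈ Finset.range (m * D + 1), binomWeight l d (1 / m) =
        m * binomTail (m * D + 1) (d + 1) (1 / m) := by
      rw [← sum_binomWeight, ← mul_assoc, mul_one_div_cancel (by positivity), one_mul]
    rw [hsum]
    have hp1 : 1 / (m : ℝ) ≤ 1 := by rw [div_le_one (by positivity)]; linarith
    have htail : binomTail (m * D + 1) (D + 1) (1 / m) ≤ binomTail (m * D + 1) (d + 1) (1 / m) :=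
      binomTail_antitone (by positivity) hp1 (by omega)
    have hδ : ((m * D : ℕ) : ℝ) + 1 ≤
        6 * ((m : ℝ) + 4) ^ 2 * (m * binomTail (m * D + 1) (D + 1) (1 / m)) * (D + 1) := by
      -- `le_binomTail` needs a positive radius; for `D = 0` the tail is exactly `1/m`.
      rcases Nat.eq_zero_or_pos D with h0 | h0
      · subst h0
        have : binomTail (m * 0 + 1) (0 + 1) (1 / (m : ℝ)) = 1 / m := by
          rw [← sum_binomWeight]; simp [binomWeight]
        rw [this, mul_one_div_cancel (by positivity)]
        push_cast
        nlinarith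
      · have hD0 : (0 : ℝ) < D := by exact_mod_cast h0
        -- With `mD` trials and radius `D` the success probability is `1/m`. The required `D ≤ c_m m
        -- D` amounts to `m + 1 ≤ m²`, which is where `m ≥ 2` enters.
        have := le_binomTail m (N := m * D) h0 (by
          push_cast
          rw [div_mul_eq_mul_div, le_div_iff₀ (by positivity)]
          nlinarith [mul_nonneg hD0.le (show (0 : ℝ) ≤ m ^ 2 - m - 1 by nlinarith)])
        rw [show (D : ℝ) / (m * D : ℕ) = 1 / m by push_cast; field_simp,
          div_le_iff₀ (by positivity)] at this
        push_cast
        nlinarith [mul_le_mul_of_nonneg_left this (show 0 ≤ (m : ℝ) * (D + 1) by positivity)]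
    have hs := sphereAvg_nonneg (N - d) z
    rw [one_div_mul_eq_div, one_div_mul_eq_div, ← mul_div_assoc, div_le_div_iff₀ (by positivity)
      (by positivity)]
    have : ((m * D : ℕ) : ℝ) + 1 ≤
        6 * ((m : ℝ) + 4) ^ 2 * (m * binomTail (m * D + 1) (d + 1) (1 / m)) * (D + 1) :=
      hδ.trans (by gcongr)
    nlinarith [mul_le_mul_of_nonneg_left this hs]
  · rw [Finset.sum_eq_zero fun d hd => sphereAvg_of_ne (by simp at hd; omega), mul_zero]
    have : 0 ≤ ∑ l ∈ Finset.range (m * D + 1), cubeConv (sphereAvg m N l) (sphereAvg m N N) z :=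
      Finset.sum_nonneg fun l _ => cubeConv_nonneg (sphereAvg_nonneg l) (sphereAvg_nonneg N) z
    positivity

theorem smoothLocalMax_ge (f : CyclicCube m N → E) (x : CyclicCube m N) {L : ℕ}
    (hL : (L : ℝ) ≤ (m : ℝ) / (m + 1) * N) :
    ‖(1 / ((L : ℕ) + 1 : ℝ)) • ∑ l ∈ Finset.range (L + 1), cubeConv (sphereAvg m N l) f x‖ ≤
      smoothLocalMax f x :=
  le_ciSup (f := fun L : {L : ℕ // (L : ℝ) ≤ (m : ℝ) / (m + 1) * N} =>
    ‖(1 / ((L : ℕ) + 1 : ℝ)) • ∑ l ∈ Finset.range ((L : ℕ) + 1), cubeConv (sphereAvg m N l) f x‖)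
    (Set.finite_range _).bddAbove ⟨L, hL⟩

theorem smoothDistantMax_le {f : CyclicCube m N → E} {x : CyclicCube m N} {B : ℝ}
    (h : ∀ D : ℕ, (D : ℝ) ≤ (N : ℝ) / (m + 1) →
      ‖(1 / ((D : ℕ) + 1 : ℝ)) • ∑ d ∈ Finset.range (D + 1), cubeConv (sphereAvg m N (N - d)) f x‖
        ≤ B) : smoothDistantMax f x ≤ B := by
  have : Nonempty {D : ℕ // (D : ℝ) ≤ (N : ℝ) / (m + 1)} := ⟨⟨0, by push_cast; positivity⟩⟩
  exact ciSup_le fun D => h D D.2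

/-- Pointwise domination of the distant by the local maximal operator. -/
theorem smoothDistantMax_le_smoothLocalMax (hm : 2 ≤ m) (f : CyclicCube m N → E)
    (x : CyclicCube m N) :
    smoothDistantMax f x ≤ 6 * ((m : ℝ) + 4) ^ 2 *
      smoothLocalMax (cubeConv (sphereAvg m N N) fun y => ‖f y‖) x := by
  refine smoothDistantMax_le fun D hD => ?_
  have hf : ∀ y, 0 ≤ ‖f y‖ := fun y => norm_nonneg _
  rw [smul_sum_cubeConv]
  refine (norm_cubeConv_le (fun y => ?_) f x).trans ?_
  · have : 0 ≤ ∑ d ∈ Finset.range (D + 1), sphereAvg m N (N - d) y :=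
      Finset.sum_nonneg fun d _ => sphereAvg_nonneg _ _
    positivity
  refine (cubeConv_mono_left (distantKernel_le hm hD) hf x).trans ?_
  -- The local radius `mD` is admissible exactly because `D ≤ N/(m+1)`.
  have hL : ((m * D : ℕ) : ℝ) ≤ (m : ℝ) / (m + 1) * N := by
    push_cast
    rw [div_mul_eq_mul_div, mul_div_assoc]
    gcongr
  have := smoothLocalMax_ge (cubeConv (sphereAvg m N N) fun y => ‖f y‖) x hL
  simp only [cubeConv_assoc, smul_sum_cubeConv] at this
  refine le_trans (le_of_eq ?_) (mul_le_mul_of_nonneg_left ((Real.le_norm_self _).trans this)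
    (show 0 ≤ 6 * ((m : ℝ) + 4) ^ 2 by positivity))
  simp only [cubeConv, Finset.mul_sum (s := Finset.univ), smul_eq_mul, mul_assoc]

/-! ### The maximal ergodic theorem on a finite set -/

section Ergodic

variable {α : Type*}

/-- The ergodic average `(g + K g + ⋯ + Kⁿ g) / (n + 1)`. -/
noncomputable def ergodicAvg (K : (α → ℝ) →ₗ[ℝ] (α → ℝ)) (g : α → ℝ) (n : ℕ) (x : α) : ℝ :=
  (∑ j ∈ Finset.range (n + 1), (K ^ j) g x) / (n + 1)

/-- The maximal ergodic average up to time `J`. -/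
noncomputable def ergodicMax (K : (α → ℝ) →ₗ[ℝ] (α → ℝ)) (g : α → ℝ) (J : ℕ) (x : α) : ℝ :=
  (Finset.range (J + 1)).sup' Finset.nonempty_range_add_one fun n => ergodicAvg K g n x

theorem ergodicAvg_le_ergodicMax (K : (α → ℝ) →ₗ[ℝ] (α → ℝ)) (g : α → ℝ) {n J : ℕ} (h : n ≤ J)
    (x : α) : ergodicAvg K g n x ≤ ergodicMax K g J x :=
  Finset.le_sup' (fun n => ergodicAvg K g n x) (by simp; omega)

theorem le_ergodicMax (K : (α → ℝ) →ₗ[ℝ] (α → ℝ)) (g : α → ℝ) (J : ℕ) (x : α) :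
    g x ≤ ergodicMax K g J x := by
  simpa [ergodicAvg] using ergodicAvg_le_ergodicMax K g (Nat.zero_le J) x

/-- Weighted sums with antitone weights are dominated by the maximal ergodic average. -/
theorem sum_antitone_mul_le {w a : ℕ → ℝ} (hw : Antitone w) (hw0 : ∀ j, 0 ≤ w j) {S : ℝ} {J : ℕ}
    (h : ∀ n ≤ J, ∑ j ∈ Finset.range n, a j ≤ n * S) :
    ∑ j ∈ Finset.range J, w j * a j ≤ S * ∑ j ∈ Finset.range J, w j := by
  -- Summation by parts, as an induction: the partial sums of `S - a j` are nonnegative, so lowering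
  -- the weight in front of them loses nothing.
  have key (n : ℕ) (hn : n ≤ J) : w n * ∑ j ∈ Finset.range n, (S - a j) ≤
      ∑ j ∈ Finset.range n, w j * (S - a j) := by
    induction n with
    | zero => simp
    | succ n ih =>
      have h1 : 0 ≤ ∑ j ∈ Finset.range (n + 1), (S - a j) := by
        have := h (n + 1) hn
        simpa [Finset.sum_sub_distrib] using this
      calc w (n + 1) * ∑ j ∈ Finset.range (n + 1), (S - a j)
          ≤ w n * ∑ j ∈ Finset.range (n + 1), (S - a j) := by gcongr; exact hw (Nat.le_succ n)
        _ ≤ _ := by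
          rw [Finset.sum_range_succ, Finset.sum_range_succ, mul_add]
          linarith [ih (by omega)]
  have h1 : 0 ≤ ∑ j ∈ Finset.range J, (S - a j) := by
    simpa [Finset.sum_sub_distrib] using h J le_rfl
  have h2 := (mul_nonneg (hw0 J) h1).trans (key J le_rfl)
  simp only [mul_sub, Finset.sum_sub_distrib] at h2
  rw [Finset.mul_sum, Finset.sum_congr rfl fun j _ => mul_comm S (w j)]
  linarith

theorem sum_mul_pow_le_ergodicMax (K : (α → ℝ) →ₗ[ℝ] (α → ℝ)) (g : α → ℝ) {w : ℕ → ℝ}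
    (hw : Antitone w) (hw0 : ∀ j, 0 ≤ w j) (J : ℕ) (x : α) :
    ∑ j ∈ Finset.range (J + 1), w j * (K ^ j) g x ≤
      ergodicMax K g J x * ∑ j ∈ Finset.range (J + 1), w j := by
  refine sum_antitone_mul_le hw hw0 fun n hn => ?_
  rcases n with _ | n
  · simp
  · have := ergodicAvg_le_ergodicMax K g (show n ≤ J by omega) x
    rw [ergodicAvg, div_le_iff₀ (by positivity)] at this
    push_cast
    linarith

variable [Fintype α]

/-- The maximal ergodic theorem (Hopf; the proof is Garsia's). -/
theorem maximal_ergodic {K : (α → ℝ) →ₗ[ℝ] (α → ℝ)} (hK : ∀ g, (∀ x, 0 ≤ g x) → ∀ x, 0 ≤ K g x)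
    (hK1 : K (fun _ => 1) = fun _ => 1) (hKs : ∀ g, ∑ x, K g x = ∑ x, g x) (g : α → ℝ) (J : ℕ)
    (t : ℝ) : 0 ≤ ∑ x with t ≤ ergodicMax K g J x, (g x - t) := by
  set h : α → ℝ := g - t • fun _ => 1 with hh
  have hKt (j : ℕ) (x : α) : (K ^ j) h x = (K ^ j) g x - t := by
    have : (K ^ j) (fun _ => 1) = fun _ => (1 : ℝ) := by
      induction j with
      | zero => rfl
      | succ j ih => rw [pow_succ', Module.End.mul_apply, ih, hK1]
    rw [hh, map_sub, map_smul, this]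
    simp
  set S : ℕ → α → ℝ := fun n => ∑ j ∈ Finset.range n, (K ^ j) h with hS
  have hSs (n : ℕ) : S (n + 1) = h + K (S n) := by
    simp only [hS]
    rw [Finset.sum_range_succ', map_sum, add_comm]
    congr 1
    exact Finset.sum_congr rfl fun j _ => by rw [pow_succ', Module.End.mul_apply]
  -- The maximum includes `S 0 = 0`, so `M ≥ 0`. Garsia's argument: `M ≤ h + K M` where the ergodic
  -- maximum reaches `t`, while elsewhere `M = 0 ≤ K M`; then `∑ (M - K M) = 0` is used.
  set M : α → ℝ := fun x => (Finset.range (J + 2)).sup' Finset.nonempty_range_add_one fun n => S n x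
    with hM
  have hSM {n : ℕ} (hn : n ≤ J + 1) (x : α) : S n x ≤ M x :=
    Finset.le_sup' (fun n => S n x) (by simp; omega)
  have hM0 (x : α) : 0 ≤ M x := by simpa [hS] using hSM (Nat.zero_le _) x
  have hS_avg (n : ℕ) (x : α) : t ≤ ergodicAvg K g n x ↔ 0 ≤ S (n + 1) x := by
    simp only [hS, Finset.sum_apply, hKt, Finset.sum_sub_distrib, ergodicAvg]
    rw [le_div_iff₀ (by positivity)]
    simp [mul_comm]
  have hmem (x : α) : t ≤ ergodicMax K g J x ↔ ∃ n ≤ J, 0 ≤ S (n + 1) x := by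
    simp only [ergodicMax, Finset.le_sup'_iff, hS_avg]
    simp
  have hon (x : α) (hx : t ≤ ergodicMax K g J x) : M x - K M x ≤ g x - t := by
    have hgh : g x - t = h x := by simp [hh]
    have step {n : ℕ} (hn : n ≤ J) : S (n + 1) x ≤ h x + K M x := by
      rw [hSs]
      have := hK (M - S n) (fun y => by simpa using hSM (by omega) y) x
      rw [map_sub] at this
      simp only [Pi.add_apply, Pi.sub_apply] at this ⊢
      linarith
    obtain ⟨n₀, hn₀, h0⟩ := (hmem x).1 hx
    have : M x ≤ h x + K M x := by
      refine Finset.sup'_le _ _ fun n hn => ?_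
      rcases n with _ | n
      -- On this set some later `S (n₀ + 1)` is nonnegative, so the term `S 0 = 0` obeys the same
      -- bound.
      · simpa [hS] using h0.trans (step hn₀)
      · exact step (by simp at hn; omega)
    linarith
  have hoff (x : α) (hx : ¬ t ≤ ergodicMax K g J x) : M x - K M x ≤ 0 := by
    have : M x ≤ 0 := by
      refine Finset.sup'_le _ _ fun n hn => ?_
      rcases n with _ | n
      · simp [hS]
      · by_contra hc
        exact hx ((hmem x).2 ⟨n, by simp at hn; omega, (not_le.1 hc).le⟩)
    linarith [hK M hM0 x]
  calc (0 : ℝ) = ∑ x, (M x - K M x) := by rw [Finset.sum_sub_distrib, hKs, sub_self]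
    _ ≤ ∑ x, if t ≤ ergodicMax K g J x then g x - t else 0 := Finset.sum_le_sum fun x _ => by
      split_ifs with hx
      · exact hon x hx
      · exact hoff x hx
    _ = _ := (Finset.sum_filter _ _).symm

/-- The passage from a strong form of the weak type inequality to `L^p`, as in Doob's inequality. -/
theorem sum_rpow_le_of_maximal {M g : α → ℝ} (hM : ∀ x, 0 ≤ M x) (hg : ∀ x, 0 ≤ g x)
    (H : ∀ t : ℝ, 0 ≤ ∑ x with t ≤ M x, (g x - t)) {p : ℝ} (hp : 1 < p) :
    ∑ x, M x ^ p ≤ (p / (p - 1)) ^ p * ∑ x, g x ^ p := by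
  have hp1 : 0 < p - 1 := by linarith
  have hp0 : 0 < p := by linarith
  obtain ⟨R, hR0, hR⟩ : ∃ R : ℝ, 0 ≤ R ∧ ∀ x, M x ≤ R :=
    ⟨∑ x, M x, Finset.sum_nonneg fun x _ => hM x, fun x =>
      Finset.single_le_sum (fun y _ => hM y) (Finset.mem_univ x)⟩
  -- The hypothesis `H t` is multiplied by `t ^ (p - 2)`, integrable at `0` since `p > 1`, and
  -- integrated over `[0, R]`. This compares `∑ M ^ p` with `∑ g * M ^ (p - 1)`, to which Hölder's
  -- inequality applies.
  set F : α → ℝ → ℝ := fun x t => g x * t ^ (p - 2) - t ^ (p - 1) with hF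
  have hFint (x : α) (b : ℝ) : IntervalIntegrable (F x) MeasureTheory.volume 0 b :=
    ((intervalIntegral.intervalIntegrable_rpow' (by linarith)).const_mul _).sub
      (intervalIntegral.intervalIntegrable_rpow' (by linarith))
  have hFval (x : α) : ∫ t in (0 : ℝ)..M x, F x t =
      g x * M x ^ (p - 1) / (p - 1) - M x ^ p / p := by
    rw [intervalIntegral.integral_sub, intervalIntegral.integral_const_mul,
      integral_rpow (Or.inl (by linarith)), integral_rpow (Or.inl (by linarith)),
      show p - 2 + 1 = p - 1 by ring, show p - 1 + 1 = p by ring, Real.zero_rpow hp1.ne',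
      Real.zero_rpow hp0.ne']
    · ring
    · exact (intervalIntegral.intervalIntegrable_rpow' (by linarith)).const_mul _
    · exact intervalIntegral.intervalIntegrable_rpow' (by linarith)
  have hind (x : α) : ∫ t in (0 : ℝ)..R, Set.indicator {t | t ≤ M x} (F x) t =
      g x * M x ^ (p - 1) / (p - 1) - M x ^ p / p := by
    rw [intervalIntegral.integral_indicator ⟨hM x, hR x⟩, hFval]
  have hindint (x : α) : IntervalIntegrable (Set.indicator {t | t ≤ M x} (F x))
      MeasureTheory.volume 0 R := by
    have := hFint x R
    rw [intervalIntegrable_iff] at this ⊢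
    exact this.indicator measurableSet_Iic
  have hpos : 0 ≤ ∑ x, (g x * M x ^ (p - 1) / (p - 1) - M x ^ p / p) := by
    rw [← Finset.sum_congr rfl fun x _ => hind x,
      ← intervalIntegral.integral_finsetSum fun x _ => hindint x]
    refine intervalIntegral.integral_nonneg hR0 fun t ht => ?_
    have h1 : t ^ (p - 1) = t * t ^ (p - 2) := by
      rcases ht.1.eq_or_lt with h0 | h0
      · rw [← h0, Real.zero_rpow hp1.ne', zero_mul]
      · rw [show p - 1 = 1 + (p - 2) by ring, Real.rpow_add h0, Real.rpow_one]
    have h2 : ∑ x, Set.indicator {t | t ≤ M x} (F x) t =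
        (∑ x with t ≤ M x, (g x - t)) * t ^ (p - 2) := by
      rw [Finset.sum_mul, Finset.sum_filter]
      refine Finset.sum_congr rfl fun x _ => ?_
      simp only [Set.indicator_apply, Set.mem_ofPred_eq, hF, h1, sub_mul]
    rw [h2]
    exact mul_nonneg (H t) (Real.rpow_nonneg ht.1 _)
  rw [Finset.sum_sub_distrib, ← Finset.sum_div, ← Finset.sum_div] at hpos
  set A := ∑ x, M x ^ p with hA
  set B := ∑ x, g x ^ p with hB
  have hA0 : 0 ≤ A := Finset.sum_nonneg fun x _ => Real.rpow_nonneg (hM x) _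
  have hB0 : 0 ≤ B := Finset.sum_nonneg fun x _ => Real.rpow_nonneg (hg x) _
  have hconj : p.HolderConjugate (p / (p - 1)) := Real.HolderConjugate.conjExponent hp
  have hhold : ∑ x, g x * M x ^ (p - 1) ≤ B ^ (1 / p) * A ^ (1 / (p / (p - 1))) := by
    have := Real.inner_le_Lp_mul_Lq_of_nonneg Finset.univ (f := g) (g := fun x => M x ^ (p - 1)) hconj
      (fun x _ => hg x) fun x _ => Real.rpow_nonneg (hM x) _
    refine this.trans_eq ?_
    have e (x : α) : (M x ^ (p - 1)) ^ (p / (p - 1)) = M x ^ p := by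
      rw [← Real.rpow_mul (hM x), mul_div_cancel₀ _ hp1.ne']
    simp only [e, hA, hB]
  -- Hölder leaves a power of `A` on the right, which can be cancelled only if `A ≠ 0`.
  rcases hA0.eq_or_lt with h0 | h0
  · rw [← h0]
    have : 0 ≤ (p / (p - 1)) ^ p := Real.rpow_nonneg (by positivity) _
    positivity
  · have h1 : A ≤ p / (p - 1) * (B ^ (1 / p) * A ^ (1 / (p / (p - 1)))) := by
      have h2 : A / p ≤ (∑ x, g x * M x ^ (p - 1)) / (p - 1) := by linarith
      rw [div_le_iff₀ hp0] at h2
      calc A ≤ p / (p - 1) * ∑ x, g x * M x ^ (p - 1) := by rw [div_mul_eq_mul_div, mul_div_assoc]; linarith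
        _ ≤ _ := by gcongr
    have h3 : A = A ^ (1 / p) * A ^ (1 / (p / (p - 1))) := by
      rw [← Real.rpow_add h0]
      conv_lhs => rw [← Real.rpow_one A]
      congr 1
      field_simp
      ring
    have h4 : A ^ (1 / p) ≤ p / (p - 1) * B ^ (1 / p) := by
      have hpos' : 0 < A ^ (1 / (p / (p - 1))) := Real.rpow_pos_of_pos h0 _
      refine le_of_mul_le_mul_right ?_ hpos'
      rw [← h3]; linarith
    have h5 := Real.rpow_le_rpow (Real.rpow_nonneg hA0 _) h4 hp0.le
    rwa [Real.mul_rpow (by positivity) (Real.rpow_nonneg hB0 _), ← Real.rpow_mul hA0,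
      ← Real.rpow_mul hB0, one_div_mul_cancel hp0.ne', Real.rpow_one, Real.rpow_one] at h5

end Ergodic

/-! ### The noise semigroup -/

/-- The law of the point obtained from the origin by independently replacing each coordinate, with
probability `p`, by a uniformly distributed nonzero element. -/
noncomputable def noiseKernel (m N : ℕ) (p : ℝ) (y : CyclicCube m N) : ℝ :=
  ∏ i, if y i = 0 then 1 - p else p / m

/-- The number of changed coordinates is binomial, and given that number the point is uniform on its
sphere. -/
theorem noiseKernel_eq (hm : 1 ≤ m) (p : ℝ) (y : CyclicCube m N) :
    noiseKernel m N p y = binomWeight N (hammingNorm y) p * sphereAvg m N (hammingNorm y) y := by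
  have c : (N.choose (hammingNorm y) : ℝ) ≠ 0 := by
    exact_mod_cast (Nat.choose_pos (hammingNorm_le y)).ne'
  have hm0 : (m : ℝ) ≠ 0 := by positivity
  rw [noiseKernel, prod_ite_zero, sphereAvg_of_eq rfl, binomWeight, div_pow]
  field_simp

theorem noiseKernel_nonneg (hm : 1 ≤ m) {p : ℝ} (h0 : 0 ≤ p) (h1 : p ≤ 1) (y : CyclicCube m N) :
    0 ≤ noiseKernel m N p y := by
  rw [noiseKernel_eq hm]
  exact mul_nonneg (binomWeight_nonneg _ _ h0 h1) (sphereAvg_nonneg _ _)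

theorem sum_noiseKernel (hm : 1 ≤ m) (p : ℝ) : ∑ y, noiseKernel m N p y = 1 := by
  have h := Finset.prod_univ_sum (fun _ : Fin N => (Finset.univ : Finset (ZMod (m + 1))))
    fun _ a => if a = 0 then 1 - p else p / m
  rw [Fintype.piFinset_univ] at h
  have hm0 : (m : ℝ) ≠ 0 := by positivity
  simp only [noiseKernel]
  rw [← h, sum_zmod_ite, mul_div_cancel₀ _ hm0]
  simp

theorem noiseKernel_zero (y : CyclicCube m N) :
    noiseKernel m N 0 y = if y = 0 then 1 else 0 := by
  rw [noiseKernel, prod_ite_zero]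
  by_cases h : y = 0
  · simp [h]
  · have : hammingNorm y ≠ 0 := by simpa using h
    simp [h, this]

/-- The quantity `1 - p (m+1)/m` is multiplicative under composition of noise. This is why the
levels of the powers of one operator are `c_m (1 - (1 - 1/N)^j)`. -/
theorem cubeConv_noiseKernel (hm : 1 ≤ m) (p q : ℝ) :
    cubeConv (noiseKernel m N p) (noiseKernel m N q) =
      noiseKernel m N (p + q - p * q * ((m + 1) / m)) := by
  funext x
  have hm0 : (m : ℝ) ≠ 0 := by positivity
  have h := Finset.prod_univ_sum (fun _ : Fin N => (Finset.univ : Finset (ZMod (m + 1))))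
    fun i a => (if a = 0 then 1 - p else p / m) * if x i - a = 0 then 1 - q else q / m
  rw [Fintype.piFinset_univ] at h
  have hc (b : ZMod (m + 1)) :
      (∑ a, (if a = 0 then 1 - p else p / m) * if b - a = 0 then 1 - q else q / m) =
        if b = 0 then 1 - (p + q - p * q * ((m + 1) / m))
        else (p + q - p * q * ((m + 1) / m)) / m := by
    have e1 (a : ZMod (m + 1)) : (if a = 0 then 1 - p else p / m) =
        p / m + if a = 0 then 1 - p - p / m else 0 := by split_ifs <;> ring
    have e2 (a : ZMod (m + 1)) : (if b - a = 0 then 1 - q else q / m) =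
        q / m + if a = b then 1 - q - q / m else 0 := by
      simp only [sub_eq_zero, eq_comm (a := b)]
      split_ifs <;> ring
    simp only [e1, e2, add_mul, mul_add, Finset.sum_add_distrib, mul_ite, ite_mul, mul_zero,
      zero_mul, Finset.sum_ite_eq', Finset.mem_univ, if_true, Finset.sum_const, Finset.card_univ,
      ZMod.card, nsmul_eq_mul]
    push_cast
    split_ifs <;> (field_simp; ring)
  simp only [hc] at h
  simp only [noiseKernel, cubeConv, smul_eq_mul, ← Finset.prod_mul_distrib]
  exact h.symm

/-- Convolution with the noise kernel as a linear operator. -/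
noncomputable def noiseOp (m N : ℕ) (p : ℝ) :
    (CyclicCube m N → ℝ) →ₗ[ℝ] (CyclicCube m N → ℝ) where
  toFun g := cubeConv (noiseKernel m N p) g
  map_add' g h := by
    funext x; simp [cubeConv, mul_add, Finset.sum_add_distrib]
  map_smul' c g := by
    funext x; simp [cubeConv, Finset.mul_sum, mul_left_comm]

/-- The noise level reached after `j` steps of size `m / (m + 1) / N`. -/
noncomputable def noiseLevel (m N j : ℕ) : ℝ := (m : ℝ) / (m + 1) * (1 - (1 - 1 / (N : ℝ)) ^ j)

/-- The increments of `noiseLevel`, with the first one repeated. -/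
noncomputable def noiseStep (m N j : ℕ) : ℝ :=
  (m : ℝ) / (m + 1) * (1 / N * (1 - 1 / (N : ℝ)) ^ (j - 1))

theorem noiseLevel_succ (m N j : ℕ) :
    noiseLevel m N (j + 1) = noiseLevel m N j + noiseStep m N (j + 1) := by
  simp only [noiseLevel, noiseStep, Nat.add_sub_cancel]; ring

theorem noiseLevel_zero (m N : ℕ) : noiseLevel m N 0 = 0 := by simp [noiseLevel]

theorem noiseLevel_one (m N : ℕ) : noiseLevel m N 1 = (m : ℝ) / (m + 1) / N := by
  simp [noiseLevel, div_eq_mul_inv]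

theorem one_sub_one_div_mem (N : ℕ) : 0 ≤ 1 - 1 / (N : ℝ) ∧ 1 - 1 / (N : ℝ) ≤ 1 := by
  have : (0 : ℝ) ≤ 1 / N := by positivity
  refine ⟨?_, by linarith⟩
  rcases Nat.eq_zero_or_pos N with h | h
  · simp [h]
  · have : (1 : ℝ) ≤ N := by exact_mod_cast h
    rw [sub_nonneg, div_le_one (by linarith)]
    exact this

theorem noiseStep_nonneg (m N j : ℕ) : 0 ≤ noiseStep m N j := by
  have := pow_nonneg (one_sub_one_div_mem N).1 (j - 1)
  unfold noiseStep; positivity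

/-- At `j = 0` the truncated `j - 1` repeats the first increment. The identity power thus gets a
weight that keeps the sequence antitone, as the comparison with ergodic averages requires. -/
theorem noiseStep_antitone (m N : ℕ) : Antitone (noiseStep m N) := fun i j hij => by
  have := one_sub_one_div_mem N
  have := pow_le_pow_of_le_one this.1 this.2 (show i - 1 ≤ j - 1 by omega)
  unfold noiseStep; gcongr

theorem noiseStep_le (m N j : ℕ) : noiseStep m N j ≤ (m : ℝ) / (m + 1) / N := by
  have := noiseStep_antitone m N (Nat.zero_le j)
  simpa [noiseStep, div_eq_mul_inv] using this

theorem noiseLevel_nonneg (m N j : ℕ) : 0 ≤ noiseLevel m N j := by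
  have := one_sub_one_div_mem N
  have : 0 ≤ 1 - (1 - 1 / (N : ℝ)) ^ j := sub_nonneg.2 (pow_le_one₀ this.1 this.2)
  unfold noiseLevel; positivity

theorem noiseLevel_le (m N j : ℕ) : noiseLevel m N j ≤ (m : ℝ) / (m + 1) := by
  have := pow_nonneg (one_sub_one_div_mem N).1 j
  exact mul_le_of_le_one_right (by positivity) (by linarith)

theorem div_add_one_le_one (m : ℕ) : (m : ℝ) / (m + 1) ≤ 1 := by
  rw [div_le_one (by positivity)]; linarith

theorem noiseLevel_le_one (m N j : ℕ) : noiseLevel m N j ≤ 1 :=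
  (noiseLevel_le m N j).trans (div_add_one_le_one m)

theorem sum_noiseStep (m N J : ℕ) :
    ∑ j ∈ Finset.range (J + 1), noiseStep m N j = noiseLevel m N J + noiseStep m N 0 := by
  induction J with
  | zero => simp [noiseLevel_zero]
  | succ J ih => rw [Finset.sum_range_succ, ih, noiseLevel_succ]; ring

theorem noiseOp_pow (hm : 1 ≤ m) (j : ℕ) (g : CyclicCube m N → ℝ) :
    (noiseOp m N (noiseLevel m N 1) ^ j) g = cubeConv (noiseKernel m N (noiseLevel m N j)) g := by
  have hm0 : (m : ℝ) ≠ 0 := by positivity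
  induction j with
  | zero =>
    funext x
    simp [noiseLevel_zero, cubeConv, noiseKernel_zero]
  | succ j ih =>
    rw [pow_succ', Module.End.mul_apply, ih]
    change cubeConv _ (cubeConv _ g) = _
    rw [cubeConv_assoc, cubeConv_noiseKernel hm]
    congr 2
    rw [noiseLevel_succ m N j, noiseStep, noiseLevel_one, Nat.add_sub_cancel, noiseLevel]
    field_simp
    ring

theorem noise_maximal_ergodic (hm : 1 ≤ m) (g : CyclicCube m N → ℝ) (J : ℕ) (t : ℝ) :
    0 ≤ ∑ x with t ≤ ergodicMax (noiseOp m N (noiseLevel m N 1)) g J x, (g x - t) := by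
  refine maximal_ergodic (fun g hg x => ?_) ?_ (fun g => ?_) g J t
  · exact cubeConv_nonneg
      (noiseKernel_nonneg hm (noiseLevel_nonneg m N 1) (noiseLevel_le_one m N 1)) hg x
  · funext x
    change cubeConv _ (fun _ => (1 : ℝ)) x = 1
    simp [cubeConv, sum_noiseKernel hm]
  · change ∑ x, cubeConv _ g x = _
    rw [sum_cubeConv, sum_noiseKernel hm, one_mul]

/-! ### Spherical averages and the noise semigroup -/

/-- Mean value inequality, with the density moved to the right endpoint `b`. The factor `ξ^k` only
grows, while `((1-ξ)/(1-b))^(N-k) ≤ (1 + m/N)^N ≤ exp m`, because `1 - b ≥ 1/(m+1)` and the step is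
at most `c_m/N`. -/
theorem binomTail_sub_le (k : ℕ) (hN : 1 ≤ N) {a b : ℝ} (ha : 0 ≤ a) (hab : a ≤ b)
    (hb : b ≤ (m : ℝ) / (m + 1)) (hba : b - a ≤ (m : ℝ) / (m + 1) / N) :
    binomTail (N + 1) (k + 1) b - binomTail (N + 1) (k + 1) a ≤
      (N + 1) * Real.exp m * ((b - a) * binomWeight N k b) := by
  have hN' : (0 : ℝ) < N := by exact_mod_cast hN
  have hb1 : 1 / ((m : ℝ) + 1) ≤ 1 - b := by
    have : (m : ℝ) / (m + 1) + 1 / (m + 1) = 1 := by field_simp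
    linarith
  have hb0 : 0 < 1 - b := lt_of_lt_of_le (by positivity) hb1
  have hle (ξ : ℝ) (h1 : a ≤ ξ) (h2 : ξ ≤ b) :
      binomWeight N k ξ ≤ Real.exp m * binomWeight N k b := by
    have e1 : 1 - ξ ≤ (1 - b) * (1 + m / N) := by
      have : (m : ℝ) / (m + 1) / N ≤ (1 - b) * (m / N) := by
        calc (m : ℝ) / (m + 1) / N = 1 / ((m : ℝ) + 1) * (m / N) := by field_simp
          _ ≤ _ := by gcongr
      linarith
    have e2 : (1 + (m : ℝ) / N) ^ (N - k) ≤ Real.exp m := by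
      calc (1 + (m : ℝ) / N) ^ (N - k) ≤ (1 + (m : ℝ) / N) ^ N :=
            pow_le_pow_right₀ (by linarith [show (0 : ℝ) ≤ m / N by positivity]) (Nat.sub_le _ _)
        _ ≤ Real.exp (m / N) ^ N := by
            gcongr
            linarith [Real.add_one_le_exp ((m : ℝ) / N)]
        _ = Real.exp m := by rw [← Real.exp_nat_mul, mul_div_cancel₀ _ hN'.ne']
    have hξ : 0 ≤ 1 - ξ := by linarith
    have hξ0 : 0 ≤ ξ := by linarith
    have hb00 : 0 ≤ b := by linarith
    calc binomWeight N k ξ ≤ N.choose k * b ^ k * ((1 - b) * (1 + m / N)) ^ (N - k) := by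
          unfold binomWeight; gcongr
      _ = (1 + (m : ℝ) / N) ^ (N - k) * binomWeight N k b := by
          rw [mul_pow, binomWeight]; ring
      _ ≤ _ := by
          gcongr
          exact binomWeight_nonneg _ _ hb00 (by linarith)
  have := Convex.image_sub_le_mul_sub_of_deriv_le (convex_Icc a b)
    (f := binomTail (N + 1) (k + 1))
    (fun p _ => (hasDerivAt_binomTail N k p).continuousAt.continuousWithinAt)
    (fun p _ => (hasDerivAt_binomTail N k p).differentiableAt.differentiableWithinAt)
    (C := (N + 1) * (Real.exp m * binomWeight N k b)) (fun p hp => by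
      rw [interior_Icc] at hp
      rw [(hasDerivAt_binomTail N k p).deriv]
      gcongr
      exact hle p hp.1.le hp.2.le) a (Set.left_mem_Icc.2 hab) b (Set.right_mem_Icc.2 hab) hab
  linarith

/-- Discrete form of writing the tail as the integral of its density: the one-step bounds telescope.
The term `j = 0` is simply discarded as nonnegative. -/
theorem binomTail_noiseLevel_le (k : ℕ) (hN : 1 ≤ N) (J : ℕ) :
    binomTail (N + 1) (k + 1) (noiseLevel m N J) ≤ (N + 1) * Real.exp m *
      ∑ j ∈ Finset.range (J + 1), noiseStep m N j * binomWeight N k (noiseLevel m N j) := by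
  have hnn (j : ℕ) : 0 ≤ noiseStep m N j * binomWeight N k (noiseLevel m N j) :=
    mul_nonneg (noiseStep_nonneg m N j)
      (binomWeight_nonneg _ _ (noiseLevel_nonneg m N j) (noiseLevel_le_one m N j))
  induction J with
  | zero =>
    rw [noiseLevel_zero, binomTail_succ_zero_prob]
    exact mul_nonneg (by positivity) (Finset.sum_nonneg fun j _ => hnn j)
  | succ J ih =>
    have e : noiseLevel m N (J + 1) - noiseLevel m N J = noiseStep m N (J + 1) := by
      rw [noiseLevel_succ]; ring
    have := binomTail_sub_le (m := m) (N := N) k hN (noiseLevel_nonneg m N J)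
      (b := noiseLevel m N (J + 1)) (by linarith [noiseStep_nonneg m N (J + 1)])
      (noiseLevel_le m N _) (by rw [e]; exact noiseStep_le m N _)
    rw [e] at this
    rw [Finset.sum_range_succ, mul_add]
    linarith

/-- For `1 ≤ L ≤ m N / (m + 1)` some noise level of size `O(L / N)` has a binomial law charging
all radii above `L`. -/
theorem exists_noiseLevel {L : ℕ} (hL : 1 ≤ L) (hLN : (L : ℝ) ≤ (m : ℝ) / (m + 1) * N) :
    ∃ J, 1 / (12 * ((m : ℝ) + 4) ^ 2) ≤ binomTail (N + 1) (L + 1) (noiseLevel m N J) ∧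
      noiseLevel m N J + noiseStep m N 0 ≤ 3 * L / N := by
  have hL' : (1 : ℝ) ≤ L := by exact_mod_cast hL
  have hN : 0 < N := by
    rcases Nat.eq_zero_or_pos N with h | h
    · subst h; norm_num at hLN; omega
    · exact h
  have hN' : (0 : ℝ) < N := by exact_mod_cast hN
  have hc1 := div_add_one_le_one m
  have hpc : (L : ℝ) / N ≤ (m : ℝ) / (m + 1) := by rwa [div_le_iff₀ hN']
  have hp0 : 0 ≤ (L : ℝ) / N := by positivity
  have htail := le_binomTail m hL hLN
  have hmono := monotoneOn_binomTail N L
  set δ := 1 / (6 * ((m : ℝ) + 4) ^ 2) with hδ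
  have hδ2 : 1 / (12 * ((m : ℝ) + 4) ^ 2) = δ / 2 := by rw [hδ]; field_simp; norm_num
  have hδ0 : 0 < δ := by positivity
  rw [hδ2]
  -- The levels tend to `c_m` but stay below it when `N > 1`. Half of `δ` is given up so that
  -- continuity at `c_m` yields a finite `J` even when `L/N = c_m`.
  have hex : ∃ J, δ / 2 ≤ binomTail (N + 1) (L + 1) (noiseLevel m N J) := by
    have hlim : Filter.Tendsto (noiseLevel m N) Filter.atTop (nhds ((m : ℝ) / (m + 1))) := by
      have h1 := tendsto_pow_atTop_nhds_zero_of_lt_one (one_sub_one_div_mem N).1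
        (by linarith [show 0 < 1 / (N : ℝ) by positivity])
      have h2 := (h1.const_sub 1).const_mul ((m : ℝ) / (m + 1))
      rwa [sub_zero, mul_one] at h2
    have h2 := (hasDerivAt_binomTail N L ((m : ℝ) / (m + 1))).continuousAt.tendsto.comp hlim
    have h3 : δ / 2 < binomTail (N + 1) (L + 1) ((m : ℝ) / (m + 1)) := by
      have := hmono ⟨hp0, hpc.trans hc1⟩ ⟨by positivity, hc1⟩ hpc
      linarith
    obtain ⟨J, hJ⟩ := (h2.eventually (lt_mem_nhds h3)).exists
    exact ⟨J, le_of_lt hJ⟩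
  classical
  -- For the least such `J` the preceding level is at most `L/N`, as beyond `L/N` the tail is
  -- already at least `δ`. The last increment and `noiseStep m N 0` cost at most `L/N` each, giving
  -- `3L/N`.
  obtain ⟨J, hJ, hmin⟩ : ∃ J, δ / 2 ≤ binomTail (N + 1) (L + 1) (noiseLevel m N J) ∧
      ∀ i < J, ¬ δ / 2 ≤ binomTail (N + 1) (L + 1) (noiseLevel m N i) :=
    ⟨Nat.find hex, Nat.find_spec hex, fun i hi => Nat.find_min hex hi⟩
  refine ⟨J, hJ, ?_⟩
  rcases J with _ | J
  · rw [noiseLevel_zero, binomTail_succ_zero_prob] at hJ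
    linarith
  · have hlt : noiseLevel m N J ≤ L / N := by
      by_contra hcon
      refine hmin J (Nat.lt_succ_self J) ?_
      have := hmono ⟨hp0, hpc.trans hc1⟩ ⟨noiseLevel_nonneg m N J, noiseLevel_le_one m N J⟩
        (not_le.1 hcon).le
      linarith
    have h1 := noiseStep_le m N (J + 1)
    have h2 := noiseStep_le m N 0
    have h3 : (m : ℝ) / (m + 1) / N ≤ L / N := by gcongr; linarith
    rw [noiseLevel_succ, mul_div_assoc]
    linarith

/-- Averages over small spheres are dominated by decreasing averages of the noise semigroup. -/
theorem sum_sphereAvg_le_noise (hm : 1 ≤ m) (hN : 1 ≤ N) {L J : ℕ}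
    (hJ : 1 / (12 * ((m : ℝ) + 4) ^ 2) ≤ binomTail (N + 1) (L + 1) (noiseLevel m N J))
    (z : CyclicCube m N) :
    ∑ l ∈ Finset.range (L + 1), sphereAvg m N l z ≤ 12 * ((m : ℝ) + 4) ^ 2 *
      ((N + 1) * Real.exp m * ∑ j ∈ Finset.range (J + 1),
        noiseStep m N j * noiseKernel m N (noiseLevel m N j) z) := by
  have h0 := noiseLevel_nonneg m N
  have h1 := noiseLevel_le_one m N
  set k := hammingNorm z with hk
  by_cases h : k ≤ L
  · rw [Finset.sum_eq_single_of_mem k (by simp; omega) fun l _ hl => sphereAvg_of_ne (Ne.symm hl)]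
    simp only [noiseKernel_eq hm, ← hk, ← mul_assoc]
    rw [← Finset.sum_mul, ← mul_assoc]
    refine le_mul_of_one_le_left (sphereAvg_nonneg _ _) ?_
    have h2 := hJ.trans ((binomTail_antitone (h0 J) (h1 J) (show k + 1 ≤ L + 1 by omega)).trans
      (binomTail_noiseLevel_le k hN J))
    rw [div_le_iff₀' (by positivity)] at h2
    linarith
  · rw [Finset.sum_eq_zero fun l hl => sphereAvg_of_ne (by simp at hl; omega)]
    have : 0 ≤ ∑ j ∈ Finset.range (J + 1),
        noiseStep m N j * noiseKernel m N (noiseLevel m N j) z :=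
      Finset.sum_nonneg fun j _ => mul_nonneg (noiseStep_nonneg m N j)
        (noiseKernel_nonneg hm (h0 j) (h1 j) z)
    positivity

/-- The density factor `N + 1` is compensated by the total weight `O(L/N)` of the noise steps,
leaving `O(L + 1)` to cancel the normalisation. The horizon `J` does not depend on `g` or `x`. -/
theorem localAvg_le_ergodicMax (hm : 1 ≤ m) {L : ℕ} (hLN : (L : ℝ) ≤ (m : ℝ) / (m + 1) * N) :
    ∃ J, ∀ g : CyclicCube m N → ℝ, (∀ x, 0 ≤ g x) → ∀ x,
      1 / ((L : ℝ) + 1) * ∑ l ∈ Finset.range (L + 1), cubeConv (sphereAvg m N l) g x ≤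
        72 * ((m : ℝ) + 4) ^ 2 * Real.exp m *
          ergodicMax (noiseOp m N (noiseLevel m N 1)) g J x := by
  rcases Nat.eq_zero_or_pos L with h0 | hL
  · refine ⟨0, fun g hg x => ?_⟩
    subst h0
    have h1 := le_ergodicMax (noiseOp m N (noiseLevel m N 1)) g 0 x
    have h2 : 1 ≤ 72 * ((m : ℝ) + 4) ^ 2 * Real.exp m := by
      have := Real.one_le_exp (show (0 : ℝ) ≤ m by positivity)
      have h3 : (1 : ℝ) ≤ 72 * ((m : ℝ) + 4) ^ 2 := by
        nlinarith [show (0 : ℝ) ≤ m by positivity]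
      nlinarith
    simp only [cubeConv_sphereAvg_zero, Nat.cast_zero, zero_add, Finset.sum_range_one, div_one,
      one_mul]
    exact h1.trans (le_mul_of_one_le_left ((hg x).trans h1) h2)
  · obtain ⟨J, hJ, hJ'⟩ := exists_noiseLevel hL hLN
    refine ⟨J, fun g hg x => ?_⟩
    have hN : 1 ≤ N := by
      rcases Nat.eq_zero_or_pos N with h | h
      · subst h; norm_num at hLN; omega
      · exact h
    have hN' : (1 : ℝ) ≤ N := by exact_mod_cast hN
    set K := noiseOp m N (noiseLevel m N 1) with hK
    have hE0 : 0 ≤ ergodicMax K g J x := (hg x).trans (le_ergodicMax K g J x)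
    have h1 := sum_mul_pow_le_ergodicMax K g (noiseStep_antitone m N) (noiseStep_nonneg m N) J x
    simp only [hK, noiseOp_pow hm] at h1
    rw [sum_noiseStep, ← hK] at h1
    have h2 := cubeConv_mono_left (sum_sphereAvg_le_noise hm hN hJ) hg x
    have e1 : cubeConv (fun z : CyclicCube m N => ∑ l ∈ Finset.range (L + 1), sphereAvg m N l z) g x =
        ∑ l ∈ Finset.range (L + 1), cubeConv (sphereAvg m N l) g x := by
      simpa using (smul_sum_cubeConv 1 (Finset.range (L + 1)) (sphereAvg m N) g x).symm
    have e2 : cubeConv (fun z : CyclicCube m N => 12 * ((m : ℝ) + 4) ^ 2 *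
        ((N + 1) * Real.exp m * ∑ j ∈ Finset.range (J + 1),
          noiseStep m N j * noiseKernel m N (noiseLevel m N j) z)) g x =
        12 * ((m : ℝ) + 4) ^ 2 * ((N + 1) * Real.exp m * ∑ j ∈ Finset.range (J + 1),
          noiseStep m N j * cubeConv (noiseKernel m N (noiseLevel m N j)) g x) := by
      simp only [cubeConv, smul_eq_mul, Finset.mul_sum, Finset.sum_mul]
      rw [Finset.sum_comm]
      exact Finset.sum_congr rfl fun j _ => Finset.sum_congr rfl fun y _ => by ring
    rw [e1, e2] at h2
    have h3 := h1.trans (mul_le_mul_of_nonneg_left hJ' hE0)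
    rw [one_div_mul_eq_div, div_le_iff₀ (by positivity)]
    refine h2.trans ?_
    -- This `6` and the `12` of `sum_sphereAvg_le_noise` make up the constant `72`.
    have h4 : ((N : ℝ) + 1) * (3 * L / N) ≤ 6 * (L + 1) := by
      rw [← mul_div_assoc, div_le_iff₀ (by linarith)]
      nlinarith [show (0 : ℝ) ≤ L by positivity]
    calc _ ≤ 12 * ((m : ℝ) + 4) ^ 2 * ((N + 1) * Real.exp m *
          (ergodicMax K g J x * (3 * L / N))) := by gcongr
      _ = 12 * ((m : ℝ) + 4) ^ 2 * Real.exp m * ergodicMax K g J x *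
          ((N + 1) * (3 * L / N)) := by ring
      _ ≤ 12 * ((m : ℝ) + 4) ^ 2 * Real.exp m * ergodicMax K g J x * (6 * (L + 1)) := by gcongr
      _ = _ := by ring

theorem ergodicMax_mono_time {α : Type*} (K : (α → ℝ) →ₗ[ℝ] (α → ℝ)) (g : α → ℝ) {J J' : ℕ}
    (h : J ≤ J') (x : α) : ergodicMax K g J x ≤ ergodicMax K g J' x :=
  Finset.sup'_mono _ (Finset.range_mono (by omega)) _

/-- The smooth local maximal operator is dominated by the maximal operator of the noise
semigroup. -/
theorem smoothLocalMax_le_ergodicMax (hm : 1 ≤ m) (N : ℕ) :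
    ∃ J, ∀ g : CyclicCube m N → ℝ, (∀ x, 0 ≤ g x) → ∀ x, smoothLocalMax g x ≤
      72 * ((m : ℝ) + 4) ^ 2 * Real.exp m * ergodicMax (noiseOp m N (noiseLevel m N 1)) g J x := by
  choose J hJ using fun L : {L : ℕ // (L : ℝ) ≤ (m : ℝ) / (m + 1) * N} =>
    localAvg_le_ergodicMax (N := N) hm L.2
  -- There are finitely many radii `L`, so one time horizon serves them all.
  obtain ⟨B, hB⟩ := (Set.finite_range J).bddAbove
  refine ⟨B, fun g hg x => ?_⟩
  have : Nonempty {L : ℕ // (L : ℝ) ≤ (m : ℝ) / (m + 1) * N} := ⟨⟨0, by push_cast; positivity⟩⟩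
  refine ciSup_le fun L => ?_
  have h0 : 0 ≤ ∑ l ∈ Finset.range ((L : ℕ) + 1), cubeConv (sphereAvg m N l) g x :=
    Finset.sum_nonneg fun l _ => cubeConv_nonneg (sphereAvg_nonneg l) hg x
  rw [smul_eq_mul, Real.norm_of_nonneg (by positivity)]
  refine (hJ L g hg x).trans (mul_le_mul_of_nonneg_left ?_ (by positivity))
  exact ergodicMax_mono_time _ g (hB ⟨L, rfl⟩) x

/-! ### Bounds for the distant maximal operator -/

theorem smoothDistantMax_nonneg (f : CyclicCube m N → E) (x : CyclicCube m N) :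
    0 ≤ smoothDistantMax f x :=
  Real.iSup_nonneg fun _ => norm_nonneg _

theorem smoothDistantMax_le_of_norm_le (hm : 1 ≤ m) {f : CyclicCube m N → E} {B : ℝ}
    (hB : ∀ x, ‖f x‖ ≤ B) (x : CyclicCube m N) : smoothDistantMax f x ≤ B := by
  refine smoothDistantMax_le fun D _ => ?_
  have hσ (d : ℕ) : ‖cubeConv (sphereAvg m N (N - d)) f x‖ ≤ B := by
    refine (norm_cubeConv_le (sphereAvg_nonneg _) f x).trans ?_
    calc _ ≤ ∑ y, sphereAvg m N (N - d) y * B := Finset.sum_le_sum fun y _ =>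
          mul_le_mul_of_nonneg_left (hB _) (sphereAvg_nonneg _ _)
      _ = B := by rw [← Finset.sum_mul, sum_sphereAvg hm (Nat.sub_le N d), one_mul]
  rw [norm_smul, Real.norm_of_nonneg (by positivity), one_div_mul_eq_div,
    div_le_iff₀ (by positivity)]
  refine (norm_sum_le_of_le _ fun d _ => hσ d).trans_eq ?_
  simp [mul_comm]

theorem sum_cubeConv_rpow_le {k g : CyclicCube m N → ℝ} (hk : ∀ y, 0 ≤ k y) (hk1 : ∑ y, k y = 1)
    (hg : ∀ y, 0 ≤ g y) {p : ℝ} (hp : 1 ≤ p) : ∑ x, cubeConv k g x ^ p ≤ ∑ x, g x ^ p := by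
  calc ∑ x, cubeConv k g x ^ p ≤ ∑ x, cubeConv k (fun y => g y ^ p) x :=
        Finset.sum_le_sum fun x _ => Real.rpow_arith_mean_le_arith_mean_rpow _ _ _
          (fun y _ => hk y) hk1 (fun y _ => hg _) hp
    _ = _ := by rw [sum_cubeConv, hk1, one_mul]

/-- The constant in the domination of the distant maximal operator by the noise semigroup. -/
noncomputable def distantConst (m : ℕ) : ℝ :=
  6 * ((m : ℝ) + 4) ^ 2 * (72 * ((m : ℝ) + 4) ^ 2 * Real.exp m)

theorem distantConst_pos (m : ℕ) : 0 < distantConst m := by unfold distantConst; positivity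

theorem smoothDistantMax_le_ergodicMax (hm : 2 ≤ m) (N : ℕ) :
    ∃ J, ∀ (f : CyclicCube m N → E) (x : CyclicCube m N), smoothDistantMax f x ≤
      distantConst m * ergodicMax (noiseOp m N (noiseLevel m N 1))
        (cubeConv (sphereAvg m N N) fun y => ‖f y‖) J x := by
  obtain ⟨J, hJ⟩ := smoothLocalMax_le_ergodicMax (m := m) (by omega) N
  refine ⟨J, fun f x => (smoothDistantMax_le_smoothLocalMax hm f x).trans ?_⟩
  rw [distantConst, mul_assoc (6 * ((m : ℝ) + 4) ^ 2)]
  exact mul_le_mul_of_nonneg_left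
    (hJ _ (cubeConv_nonneg (sphereAvg_nonneg N) fun y => norm_nonneg _) x) (by positivity)

/-- The maximal ergodic theorem at height `t / distantConst m`; convolution with `σ_N` preserves the
sum of `‖f‖`. -/
theorem smoothDistantMax_weak_type (hm : 2 ≤ m) (f : CyclicCube m N → E) {t : ℝ} (ht : 0 < t) :
    t * ((Finset.univ.filter fun x => t < smoothDistantMax f x).card : ℝ) ≤
      distantConst m * ∑ x, ‖f x‖ := by
  have hm1 : 1 ≤ m := by omega
  obtain ⟨J, hJ⟩ := smoothDistantMax_le_ergodicMax (E := E) hm N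
  set g := cubeConv (sphereAvg m N N) fun y => ‖f y‖ with hg
  have hg0 : ∀ x, 0 ≤ g x := cubeConv_nonneg (sphereAvg_nonneg N) fun y => norm_nonneg _
  have hgs : ∑ x, g x = ∑ x, ‖f x‖ := by rw [hg, sum_cubeConv, sum_sphereAvg hm1 le_rfl, one_mul]
  have hC := distantConst_pos m
  set S := Finset.univ.filter fun x =>
    t / distantConst m ≤ ergodicMax (noiseOp m N (noiseLevel m N 1)) g J x with hS
  have hmax := noise_maximal_ergodic hm1 g J (t / distantConst m)
  rw [← hS, Finset.sum_sub_distrib, Finset.sum_const, nsmul_eq_mul] at hmax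
  have h1 : ∑ x ∈ S, g x ≤ ∑ x, g x :=
    Finset.sum_le_univ_sum_of_nonneg hg0
  have hsub : (Finset.univ.filter fun x => t < smoothDistantMax f x) ⊆ S := fun x hx => by
    simp only [hS, Finset.mem_filter, Finset.mem_univ, true_and] at hx ⊢
    rw [div_le_iff₀' hC]
    exact hx.le.trans (hJ f x)
  have hcard : ((Finset.univ.filter fun x => t < smoothDistantMax f x).card : ℝ) ≤ S.card := by
    exact_mod_cast Finset.card_le_card hsub
  rw [← hgs]
  have h2 : S.card * t ≤ distantConst m * ∑ x, g x := by
    have : S.card * (t / distantConst m) ≤ ∑ x, g x := by linarith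
    rw [← mul_div_assoc, div_le_iff₀' hC] at this
    exact this
  nlinarith

theorem sum_smoothDistantMax_rpow_le (hm : 2 ≤ m) (f : CyclicCube m N → E) {p : ℝ} (hp : 1 < p) :
    ∑ x, smoothDistantMax f x ^ p ≤ (distantConst m * (p / (p - 1))) ^ p * ∑ x, ‖f x‖ ^ p := by
  have hm1 : 1 ≤ m := by omega
  obtain ⟨J, hJ⟩ := smoothDistantMax_le_ergodicMax (E := E) hm N
  set g := cubeConv (sphereAvg m N N) fun y => ‖f y‖ with hg
  have hg0 : ∀ x, 0 ≤ g x := cubeConv_nonneg (sphereAvg_nonneg N) fun y => norm_nonneg _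
  have hC := (distantConst_pos m).le
  set M := ergodicMax (noiseOp m N (noiseLevel m N 1)) g J with hM
  have hM0 (x) : 0 ≤ M x := (hg0 x).trans (le_ergodicMax _ g J x)
  have hp1 : 0 ≤ p / (p - 1) := div_nonneg (by linarith) (by linarith)
  calc ∑ x, smoothDistantMax f x ^ p ≤ ∑ x, (distantConst m * M x) ^ p :=
        Finset.sum_le_sum fun x _ => Real.rpow_le_rpow (smoothDistantMax_nonneg f x) (hJ f x)
          (by linarith)
    _ = distantConst m ^ p * ∑ x, M x ^ p := by
        rw [Finset.mul_sum]
        exact Finset.sum_congr rfl fun x _ => Real.mul_rpow hC (hM0 x)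
    _ ≤ distantConst m ^ p * ((p / (p - 1)) ^ p * ∑ x, g x ^ p) := by
        gcongr
        exact sum_rpow_le_of_maximal hM0 hg0 (noise_maximal_ergodic hm1 g J) hp
    _ ≤ distantConst m ^ p * ((p / (p - 1)) ^ p * ∑ x, ‖f x‖ ^ p) := by
        gcongr _ * (_ * ?_)
        exact sum_cubeConv_rpow_le (sphereAvg_nonneg N) (sum_sphereAvg hm1 le_rfl)
          (fun y => norm_nonneg (f y)) hp.le
    _ = _ := by rw [Real.mul_rpow hC hp1, mul_assoc]

theorem eLpNorm_count_eq_ofReal {α F : Type*} [Fintype α] [MeasurableSpace α]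
    [MeasurableSingletonClass α] [NormedAddCommGroup F] (f : α → F) {p : ℝ≥0∞} (hp0 : p ≠ 0)
    (hp : p ≠ ∞) : MeasureTheory.eLpNorm f p MeasureTheory.Measure.count =
      ENNReal.ofReal ((∑ x, ‖f x‖ ^ p.toReal) ^ (1 / p.toReal)) := by
  have hp' : 0 < p.toReal := ENNReal.toReal_pos hp0 hp
  rw [MeasureTheory.eLpNorm_eq_lintegral_rpow_enorm_toReal hp0 hp, MeasureTheory.lintegral_count,
    tsum_fintype, ← ENNReal.ofReal_rpow_of_nonneg
      (Finset.sum_nonneg fun x _ => Real.rpow_nonneg (norm_nonneg _) _) (by positivity),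
    ENNReal.ofReal_sum_of_nonneg fun x _ => Real.rpow_nonneg (norm_nonneg _) _]
  congr 1
  refine Finset.sum_congr rfl fun x _ => ?_
  rw [← ENNReal.ofReal_rpow_of_nonneg (norm_nonneg _) hp'.le, ofReal_norm]

theorem eLpNorm_smoothDistantMax_le (hm : 2 ≤ m) (f : CyclicCube m N → E) {p : ℝ≥0∞} (hp1 : 1 < p)
    (hp : p ≠ ∞) : MeasureTheory.eLpNorm (smoothDistantMax f) p MeasureTheory.Measure.count ≤
      (distantConst m * (p.toReal / (p.toReal - 1))).toNNReal *
        MeasureTheory.eLpNorm f p MeasureTheory.Measure.count := by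
  have hp0 : p ≠ 0 := (zero_lt_one.trans hp1).ne'
  have hpr : 1 < p.toReal := by
    simpa using (ENNReal.toReal_lt_toReal ENNReal.one_ne_top hp).2 hp1
  have hA : 0 ≤ distantConst m * (p.toReal / (p.toReal - 1)) :=
    mul_nonneg (distantConst_pos m).le (div_nonneg (by linarith) (by linarith))
  have hs : 0 ≤ ∑ x, ‖f x‖ ^ p.toReal :=
    Finset.sum_nonneg fun x _ => Real.rpow_nonneg (norm_nonneg _) _
  rw [eLpNorm_count_eq_ofReal _ hp0 hp, eLpNorm_count_eq_ofReal _ hp0 hp]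
  -- The coercion of `Real.toNNReal` to `ℝ≥0∞` is `ENNReal.ofReal` by definition.
  change _ ≤ ENNReal.ofReal _ * _
  rw [← ENNReal.ofReal_mul hA]
  refine ENNReal.ofReal_le_ofReal ?_
  simp only [Real.norm_of_nonneg (smoothDistantMax_nonneg f _)]
  refine (Real.rpow_le_rpow
    (Finset.sum_nonneg fun x _ => Real.rpow_nonneg (smoothDistantMax_nonneg f x) _)
    (sum_smoothDistantMax_rpow_le hm f hpr) (by positivity)).trans_eq ?_
  rw [Real.mul_rpow (Real.rpow_nonneg hA _) hs, ← Real.rpow_mul hA,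
    mul_one_div_cancel (by linarith), Real.rpow_one]

theorem eLpNorm_top_smoothDistantMax_le (hm : 1 ≤ m) (f : CyclicCube m N → E) :
    MeasureTheory.eLpNorm (smoothDistantMax f) ∞ MeasureTheory.Measure.count ≤
      MeasureTheory.eLpNorm f ∞ MeasureTheory.Measure.count := by
  simp only [MeasureTheory.eLpNorm_exponent_top, MeasureTheory.eLpNormEssSup_count]
  obtain ⟨x₀, hx₀⟩ := Finite.exists_max fun x => ‖f x‖
  refine iSup_le fun x => le_trans ?_ (le_iSup (fun y => ‖f y‖ₑ) x₀)
  rw [← ofReal_norm, ← ofReal_norm, Real.norm_of_nonneg (smoothDistantMax_nonneg f x)]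
  exact ENNReal.ofReal_le_ofReal (smoothDistantMax_le_of_norm_le hm hx₀ x)

end

theorem mainTheorem10 (m : ℕ) (hm : 2 ≤ m) :
    -- pointwise domination for nonnegative functions, with a constant depending only on `m`
    (∃ C : ℝ, ∀ (N : ℕ) (f : CyclicCube m N → ℝ), (∀ x, 0 ≤ f x) →
      ∀ x, smoothDistantMax f x ≤ C * smoothLocalMax (cubeConv (sphereAvg m N N) f) x) ∧
    -- weak type (1,1), with a constant depending only on `m`
    (∃ C : ℝ, ∀ (N : ℕ) (f : CyclicCube m N → ℂ) (t : ℝ), 0 < t →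
      t * ((Finset.univ.filter fun x => t < smoothDistantMax f x).card : ℝ) ≤ C * ∑ x, ‖f x‖) ∧
    -- boundedness on `L^p`, `1 < p ≤ ∞`, with a constant depending only on `m` and `p`
    (∀ p : ℝ≥0∞, 1 < p → ∃ C : ℝ≥0, ∀ (N : ℕ) (f : CyclicCube m N → ℂ),
      MeasureTheory.eLpNorm (smoothDistantMax f) p MeasureTheory.Measure.count ≤
        C * MeasureTheory.eLpNorm f p MeasureTheory.Measure.count) := by
  refine ⟨⟨6 * ((m : ℝ) + 4) ^ 2, fun N f hf x => ?_⟩,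
    ⟨distantConst m, fun N f t ht => smoothDistantMax_weak_type hm f ht⟩, fun p hp => ?_⟩
  · have h := smoothDistantMax_le_smoothLocalMax hm f x
    simpa only [Real.norm_of_nonneg (hf _)] using h
  · rcases eq_or_ne p ∞ with rfl | hp'
    · refine ⟨1, fun N f => ?_⟩
      simpa using eLpNorm_top_smoothDistantMax_le (by omega) f
    · exact ⟨_, fun N f => eLpNorm_smoothDistantMax_le hm f hp hp'⟩
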